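/- Let $\mathbb{D}$ be the open unit disk in $\mathbb{C}$ and let $H^2$ be the Hardy space, i.e. the space of all analytic functions $f$ on $\mathbb{D}$ with $\|f\|^2=\lim_{r\to1^-}\frac{1}{2\pi}\int_0^{2\pi}|f(re^{i\theta})|^2\,d\theta<\infty$. Let $\varphi:\mathbb{D}\to\mathbb{D}$ be univalent (analytic and injective), let $n$ be a positive integer, and let $D_{\varphi,n}$ be the operator $D_{\varphi,n}(f)=f^{(n)}\circ\varphi$. Then the following hold. (i) $D_{\varphi,n}$ is bounded on $H^2$ (that is, it maps $H^2$ into $H^2$ and there is a constant $C$ with $\|D_{\varphi,n}f\|\le C\|f\|$ for all $f\in H^2$) if and only if $$\sup_{w\in\mathbb{D}}\frac{1-|w|}{(1-|\varphi(w)|)^{2n+1}}<\infty.$$ (ii) $D_{\varphi,n}$ is compact on $H^2$ (that is, it maps $H^2$ into $H^2$ and is a compact linear operator there) if and only if $$\lim_{|w|\to1^-}\frac{1-|w|}{(1-|\varphi(w)|)^{2n+1}}=0.$$ -/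

import Mathlib

open Complex Real Set Filter Topology Metric
open scoped ComplexConjugate

noncomputable section

/-! ### The Hardy space of the unit disk

An analytic function on the open unit disk `ball 0 1` is encoded as a function `ℂ → ℂ` that is
complex differentiable on the disk and is extended by `0` outside of it, so that two elements are
equal exactly when they agree on the disk. -/

/-- The integral mean `(1 / 2π) ∫₀^{2π} |f (r e^{iθ})|² dθ`. -/
def hardyMean (f : ℂ → ℂ) (r : ℝ) : ℝ :=
  (2 * π)⁻¹ * ∫ θ in (0 : ℝ)..2 * π, ‖f (r * exp (θ * I))‖ ^ 2

/-- The sesquilinear mean `(1 / 2π) ∫₀^{2π} conj (f (r e^{iθ})) g (r e^{iθ}) dθ`. -/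
def hardyInnerMean (f g : ℂ → ℂ) (r : ℝ) : ℂ :=
  (2 * π : ℂ)⁻¹ * ∫ θ in (0 : ℝ)..2 * π, conj (f (r * exp (θ * I))) * g (r * exp (θ * I))

/-- `f` belongs to `H²`: it is analytic on the unit disk (and `0` outside of the disk), and its
integral means have a finite limit as `r → 1⁻`. -/
structure IsHardy (f : ℂ → ℂ) : Prop where
  differentiableOn : DifferentiableOn ℂ f (ball 0 1)
  eq_zero : ∀ z ∉ ball (0 : ℂ) 1, f z = 0
  exists_lim : ∃ L : ℝ, Tendsto (hardyMean f) (𝓝[<] 1) (𝓝 L)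

section Aux

theorem hardy_circle_mem {r : ℝ} (hr : r ∈ Ico (0 : ℝ) 1) (θ : ℝ) :
    (r * exp (θ * I) : ℂ) ∈ ball (0 : ℂ) 1 := by
  simp [norm_exp_ofReal_mul_I, abs_of_nonneg hr.1, hr.2]

theorem hardy_continuous {f : ℂ → ℂ} (hf : DifferentiableOn ℂ f (ball 0 1)) {r : ℝ}
    (hr : r ∈ Ico (0 : ℝ) 1) : Continuous fun θ : ℝ => f (r * exp (θ * I)) :=
  hf.continuousOn.comp_continuous (by fun_prop) (hardy_circle_mem hr)

theorem hardyMean_nonneg (f : ℂ → ℂ) (r : ℝ) : 0 ≤ hardyMean f r := by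
  refine mul_nonneg (by positivity) (intervalIntegral.integral_nonneg (by positivity) ?_)
  intros
  positivity

theorem hardyInnerMean_self (f : ℂ → ℂ) (r : ℝ) :
    hardyInnerMean f f r = (hardyMean f r : ℂ) := by
  simp only [hardyInnerMean, hardyMean, conj_mul']
  push_cast
  rw [← intervalIntegral.integral_ofReal]
  push_cast
  rfl

theorem hardyMean_add_le {f g : ℂ → ℂ} (hf : DifferentiableOn ℂ f (ball 0 1))
    (hg : DifferentiableOn ℂ g (ball 0 1)) {r : ℝ} (hr : r ∈ Ico (0 : ℝ) 1) :
    hardyMean (f + g) r ≤ 2 * (hardyMean f r + hardyMean g r) := by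
  have h1 := hardy_continuous hf hr
  have h2 := hardy_continuous hg hr
  have : ∫ θ in (0 : ℝ)..2 * π, ‖(f + g) (r * exp (θ * I))‖ ^ 2 ≤
      ∫ θ in (0 : ℝ)..2 * π,
        (2 * ‖f (r * exp (θ * I))‖ ^ 2 + 2 * ‖g (r * exp (θ * I))‖ ^ 2) := by
    refine intervalIntegral.integral_mono_on (by positivity)
      (Continuous.intervalIntegrable ?_ _ _) (Continuous.intervalIntegrable ?_ _ _) ?_
    · exact ((h1.add h2).norm.pow 2)
    · exact ((h1.norm.pow 2).const_mul 2).add ((h2.norm.pow 2).const_mul 2)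
    · intro θ _
      have := norm_add_le (f (r * exp (θ * I))) (g (r * exp (θ * I)))
      simp only [Pi.add_apply]
      nlinarith [norm_nonneg (f (r * exp (θ * I)) + g (r * exp (θ * I))),
        sq_nonneg (‖f (r * exp (θ * I))‖ - ‖g (r * exp (θ * I))‖)]
  have i1 : Continuous fun θ : ℝ => 2 * ‖f (r * exp (θ * I))‖ ^ 2 := (h1.norm.pow 2).const_mul 2
  have i2 : Continuous fun θ : ℝ => 2 * ‖g (r * exp (θ * I))‖ ^ 2 := (h2.norm.pow 2).const_mul 2
  rw [intervalIntegral.integral_add (i1.intervalIntegrable _ _) (i2.intervalIntegrable _ _),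
    intervalIntegral.integral_const_mul,
    intervalIntegral.integral_const_mul] at this
  unfold hardyMean
  have hp : 0 ≤ (2 * π)⁻¹ := by positivity
  nlinarith [mul_le_mul_of_nonneg_left this hp]

theorem hardyMean_smul (c : ℂ) (f : ℂ → ℂ) (r : ℝ) :
    hardyMean (c • f) r = ‖c‖ ^ 2 * hardyMean f r := by
  simp only [hardyMean, Pi.smul_apply, norm_smul, mul_pow, intervalIntegral.integral_const_mul]
  ring

theorem hardy_coeff {f : ℂ → ℂ} (hf : DifferentiableOn ℂ f (ball 0 1)) {r : ℝ}
    (hr : r ∈ Ioo (0 : ℝ) 1) (n : ℕ) :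
    ∫ θ in (0 : ℝ)..2 * π, conj ((r * exp (θ * I) : ℂ) ^ n) * f (r * exp (θ * I)) =
      2 * π * r ^ (2 * n) * ((n.factorial : ℂ)⁻¹ * iteratedDeriv n f 0) := by
  have h := (hf.mono (closedBall_subset_ball hr.2)).circleIntegral_one_div_sub_center_pow_smul
    hr.1 n
  have hI : ∀ θ : ℝ, conj ((r * exp (θ * I) : ℂ) ^ n) * f (r * exp (θ * I)) =
      (r : ℂ) ^ (2 * n) * I⁻¹ * (deriv (circleMap 0 r) θ •
        ((1 / (circleMap 0 r θ - 0) ^ (n + 1)) • f (circleMap 0 r θ))) := by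
    intro θ
    have hr0 : (r : ℂ) ≠ 0 := by exact_mod_cast hr.1.ne'
    have he := exp_ne_zero (θ * I)
    have hc : conj (exp (θ * I)) = (exp (θ * I))⁻¹ := by
      rw [← exp_conj, ← Complex.exp_neg]; simp
    simp only [deriv_circleMap, circleMap, zero_add, sub_zero, smul_eq_mul, map_pow, map_mul,
      conj_ofReal, hc]
    rw [mul_pow, inv_pow]
    field_simp
    ring
  simp_rw [hI]
  rw [intervalIntegral.integral_const_mul]
  have : (∫ θ in (0 : ℝ)..2 * π, deriv (circleMap 0 r) θ •
        ((1 / (circleMap 0 r θ - 0) ^ (n + 1)) • f (circleMap 0 r θ))) = _ := h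
  rw [this, smul_eq_mul]
  field_simp

/-- Parseval's identity. -/
theorem hardyMean_hasSum {f : ℂ → ℂ} (hf : DifferentiableOn ℂ f (ball 0 1)) {r : ℝ}
    (hr : r ∈ Ioo (0 : ℝ) 1) :
    HasSum (fun n : ℕ => ‖(n.factorial : ℂ)⁻¹ * iteratedDeriv n f 0‖ ^ 2 * r ^ (2 * n))
      (hardyMean f r) := by
  set a : ℕ → ℂ := fun n => (n.factorial : ℂ)⁻¹ * iteratedDeriv n f 0 with ha
  have hr' : r ∈ Ico (0 : ℝ) 1 := ⟨hr.1.le, hr.2⟩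
  have htay : ∀ z ∈ ball (0 : ℂ) 1, HasSum (fun n => a n * z ^ n) (f z) := by
    intro z hz
    have := hasSum_taylorSeries_on_ball hf hz
    simpa [ha, mul_assoc, mul_comm, mul_left_comm] using this
  have hsum : Summable fun n => ‖a n‖ * r ^ n := by
    have := (htay (r : ℂ) (by simp [abs_of_pos hr.1, hr.2])).summable.norm
    simpa [abs_of_pos hr.1] using this
  obtain ⟨C, hC⟩ : ∃ C, ∀ θ ∈ Icc (0 : ℝ) (2 * π), ‖f (r * exp (θ * I))‖ ≤ C :=
    isCompact_Icc.exists_bound_of_continuousOn (hardy_continuous hf hr').continuousOn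
  have key := intervalIntegral.hasSum_integral_of_dominated_convergence
    (μ := MeasureTheory.volume) (a := 0) (b := 2 * π)
    (F := fun n (θ : ℝ) => conj (a n * (r * exp (θ * I) : ℂ) ^ n) * f (r * exp (θ * I)))
    (f := fun θ => conj (f (r * exp (θ * I))) * f (r * exp (θ * I)))
    (fun n _ => ‖a n‖ * r ^ n * C) ?_ ?_ ?_ ?_ ?_
  · have h2 := key.mul_left (2 * π : ℂ)⁻¹
    change HasSum _ (hardyInnerMean f f r) at h2
    rw [hardyInnerMean_self] at h2
    rw [← Complex.hasSum_ofReal]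
    refine h2.congr_fun ?_ |> fun h => h
    intro n
    simp only [map_mul, mul_assoc]
    rw [intervalIntegral.integral_const_mul, hardy_coeff hf hr]
    have : conj (a n) * a n = (‖a n‖ : ℂ) ^ 2 := conj_mul' _
    change _ = (2 * π : ℂ)⁻¹ * (conj (a n) * (2 * π * r ^ (2 * n) * a n))
    push_cast
    rw [← this]
    have hp : (π : ℂ) ≠ 0 := by exact_mod_cast pi_ne_zero
    field_simp
  · intro n
    have := hardy_continuous hf hr'
    exact ((continuous_conj.comp (by fun_prop :
      Continuous fun θ : ℝ => a n * (r * exp (θ * I) : ℂ) ^ n)).mul this).aestronglyMeasurable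
  · intro n
    refine .of_forall fun θ hθ => ?_
    rw [uIoc_of_le (by positivity)] at hθ
    rw [norm_mul, RCLike.norm_conj]
    refine mul_le_mul (le_of_eq ?_) (hC θ ⟨hθ.1.le, hθ.2⟩) (norm_nonneg _)
      (mul_nonneg (norm_nonneg _) (pow_nonneg hr.1.le _))
    simp [norm_exp_ofReal_mul_I, abs_of_pos hr.1]
  · exact .of_forall fun θ _ => hsum.mul_right C
  · exact intervalIntegrable_const
  · refine .of_forall fun θ _ => ?_
    exact ((Complex.hasSum_conj'.2 (by simpa using htay _ (hardy_circle_mem hr' θ)))).mul_right _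

theorem hardyMean_monotoneOn {f : ℂ → ℂ} (hf : DifferentiableOn ℂ f (ball 0 1)) :
    MonotoneOn (hardyMean f) (Ioo 0 1) := by
  intro r hr s hs hrs
  refine hasSum_le (fun n => ?_) (hardyMean_hasSum hf hr) (hardyMean_hasSum hf hs)
  exact mul_le_mul_of_nonneg_left (pow_le_pow_left₀ hr.1.le hrs _) (by positivity)

theorem hardy_nhds : Ioo (0 : ℝ) 1 ∈ 𝓝[<] (1 : ℝ) := Ioo_mem_nhdsLT zero_lt_one

theorem hardyMean_le_lim {f : ℂ → ℂ} (hf : DifferentiableOn ℂ f (ball 0 1)) {L : ℝ}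
    (hL : Tendsto (hardyMean f) (𝓝[<] 1) (𝓝 L)) {r : ℝ} (hr : r ∈ Ioo (0 : ℝ) 1) :
    hardyMean f r ≤ L := by
  refine ge_of_tendsto hL ?_
  filter_upwards [Ioo_mem_nhdsLT hr.2] with s hs
  exact hardyMean_monotoneOn hf hr ⟨hr.1.trans hs.1, hs.2⟩ hs.1.le

theorem hardy_exists_lim {f : ℂ → ℂ} (hf : DifferentiableOn ℂ f (ball 0 1)) {C : ℝ}
    (hC : ∀ r ∈ Ioo (0 : ℝ) 1, hardyMean f r ≤ C) :
    ∃ L : ℝ, Tendsto (hardyMean f) (𝓝[<] 1) (𝓝 L) := by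
  refine ⟨_, (hardyMean_monotoneOn hf).tendsto_nhdsWithin_Ioo_left (by simp) ?_⟩
  exact ⟨C, by rintro _ ⟨r, hr, rfl⟩; exact hC r hr⟩

theorem IsHardy.add {f g : ℂ → ℂ} (hf : IsHardy f) (hg : IsHardy g) : IsHardy (f + g) where
  differentiableOn := hf.1.add hg.1
  eq_zero z hz := by simp [hf.2 z hz, hg.2 z hz]
  exists_lim := by
    obtain ⟨L, hL⟩ := hf.3
    obtain ⟨M, hM⟩ := hg.3
    refine hardy_exists_lim (hf.1.add hg.1) (C := 2 * (L + M)) fun r hr => ?_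
    have := hardyMean_add_le hf.1 hg.1 ⟨hr.1.le, hr.2⟩
    linarith [hardyMean_le_lim hf.1 hL hr, hardyMean_le_lim hg.1 hM hr]

theorem IsHardy.smul (c : ℂ) {f : ℂ → ℂ} (hf : IsHardy f) : IsHardy (c • f) where
  differentiableOn := hf.1.const_smul c
  eq_zero z hz := by simp [hf.2 z hz]
  exists_lim := by
    obtain ⟨L, hL⟩ := hf.3
    exact ⟨‖c‖ ^ 2 * L, (hL.const_mul (‖c‖ ^ 2)).congr fun r => (hardyMean_smul c f r).symm⟩

theorem IsHardy.zero : IsHardy 0 where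
  differentiableOn := differentiableOn_const 0
  eq_zero _ _ := rfl
  exists_lim := ⟨0, tendsto_const_nhds.congr fun r => by simp [hardyMean]⟩

end Aux

/-- The functions in `H²`, as a complex vector space. -/
def hardySubmodule : Submodule ℂ (ℂ → ℂ) where
  carrier := {f | IsHardy f}
  add_mem' := IsHardy.add
  zero_mem' := IsHardy.zero
  smul_mem' c _ hf := hf.smul c

/-- The Hardy space `H²` of the unit disk. -/
def HardySpace : Type := ↥hardySubmodule

namespace HardySpace

instance : AddCommGroup HardySpace := inferInstanceAs (AddCommGroup ↥hardySubmodule)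

instance : Module ℂ HardySpace := inferInstanceAs (Module ℂ ↥hardySubmodule)

instance : FunLike HardySpace ℂ ℂ where
  coe f := Subtype.val (p := (· ∈ hardySubmodule)) f
  coe_injective _ _ h := Subtype.ext h

theorem isHardy (f : HardySpace) : IsHardy f := f.2

theorem coe_add (f g : HardySpace) : (⇑(f + g) : ℂ → ℂ) = ⇑f + ⇑g := rfl

theorem coe_smul (c : ℂ) (f : HardySpace) : (⇑(c • f) : ℂ → ℂ) = c • ⇑f := rfl

theorem coe_zero : (⇑(0 : HardySpace) : ℂ → ℂ) = 0 := rfl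

/-- The inner product of `H²`, the limit as `r → 1⁻` of the sesquilinear means; it is conjugate
linear in the first variable, as is customary in Mathlib. -/
instance : Inner ℂ HardySpace := ⟨fun f g => limUnder (𝓝[<] 1) (hardyInnerMean f g)⟩

theorem tendsto_inner (f g : HardySpace) :
    Tendsto (hardyInnerMean f g) (𝓝[<] 1) (𝓝 (inner ℂ f g)) := by
  refine tendsto_nhds_limUnder ?_
  obtain ⟨L₁, h₁⟩ := (f + g).isHardy.exists_lim
  obtain ⟨L₂, h₂⟩ := (f + (-1 : ℂ) • g).isHardy.exists_lim
  obtain ⟨L₃, h₃⟩ := (f + (-I) • g).isHardy.exists_lim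
  obtain ⟨L₄, h₄⟩ := (f + I • g).isHardy.exists_lim
  have c := fun {h : ℝ → ℝ} {L : ℝ} (H : Tendsto h (𝓝[<] 1) (𝓝 L)) =>
    (continuous_ofReal.tendsto L).comp H
  refine ⟨_, (((c h₁).sub (c h₂)).add (((c h₃).sub (c h₄)).mul_const I)
    |>.div_const 4).congr' ?_⟩
  filter_upwards [hardy_nhds] with r hr
  have hr' : r ∈ Ico (0 : ℝ) 1 := ⟨hr.1.le, hr.2⟩
  have hf := hardy_continuous f.isHardy.1 hr'
  have hg := hardy_continuous g.isHardy.1 hr'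
  obtain ⟨u, hu⟩ : ∃ u : ℝ → ℂ, ∀ θ : ℝ, u θ = f (r * exp (θ * I)) := ⟨_, fun _ => rfl⟩
  obtain ⟨v, hv⟩ : ∃ v : ℝ → ℂ, ∀ θ : ℝ, v θ = g (r * exp (θ * I)) := ⟨_, fun _ => rfl⟩
  simp_rw [← hu] at hf
  simp_rw [← hv] at hg
  simp only [Function.comp_apply, ← hardyInnerMean_self, hardyInnerMean, coe_add, coe_smul,
    Pi.add_apply, Pi.smul_apply, smul_eq_mul]
  rw [← mul_sub, ← mul_sub, mul_assoc _ _ I, ← mul_add, mul_div_assoc]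
  congr 1
  rw [← intervalIntegral.integral_sub, ← intervalIntegral.integral_sub,
    ← intervalIntegral.integral_mul_const, ← intervalIntegral.integral_add,
    ← intervalIntegral.integral_div]
  · refine intervalIntegral.integral_congr fun θ _ => ?_
    simp only [map_add, map_mul, map_neg, conj_I, map_one]
    ring_nf
    simp only [I_sq]
    ring
  all_goals
    refine Continuous.intervalIntegrable ?_ _ _
    simp_rw [← hu, ← hv]
    fun_prop

theorem tendsto_inner_self (f : HardySpace) :
    Tendsto (hardyMean f) (𝓝[<] 1) (𝓝 (inner ℂ f f).re) := by
  have := (continuous_re.tendsto _).comp (tendsto_inner f f)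
  exact this.congr fun r => by simp [hardyInnerMean_self]

/-- The inner product axioms. -/
@[reducible] def core : InnerProductSpace.Core ℂ HardySpace where
  conj_inner_symm f g := by
    refine tendsto_nhds_unique ((continuous_conj.tendsto _).comp (tendsto_inner g f))
      ((tendsto_inner f g).congr fun r => ?_)
    simp only [hardyInnerMean, Function.comp_apply, map_mul, map_inv₀, conj_ofReal, map_ofNat,
      intervalIntegral.integral_of_le two_pi_pos.le, ← integral_conj, conj_conj]
    simp only [mul_comm]
  re_inner_nonneg f :=
    ge_of_tendsto (tendsto_inner_self f) (.of_forall fun r => hardyMean_nonneg _ r)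
  add_left f g h := by
    refine tendsto_nhds_unique (tendsto_inner (f + g) h)
      (((tendsto_inner f h).add (tendsto_inner g h)).congr' ?_)
    filter_upwards [hardy_nhds] with r hr
    have hr' : r ∈ Ico (0 : ℝ) 1 := ⟨hr.1.le, hr.2⟩
    have hf := hardy_continuous f.isHardy.1 hr'
    have hg := hardy_continuous g.isHardy.1 hr'
    have hh := hardy_continuous h.isHardy.1 hr'
    simp only [hardyInnerMean, coe_add, Pi.add_apply, map_add, add_mul]
    have i1 : Continuous fun θ : ℝ => conj (f (r * exp (θ * I))) * h (r * exp (θ * I)) :=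
      (continuous_conj.comp hf).mul hh
    have i2 : Continuous fun θ : ℝ => conj (g (r * exp (θ * I))) * h (r * exp (θ * I)) :=
      (continuous_conj.comp hg).mul hh
    rw [intervalIntegral.integral_add (i1.intervalIntegrable _ _) (i2.intervalIntegrable _ _),
      mul_add]
  smul_left f g c := by
    refine tendsto_nhds_unique (tendsto_inner (c • f) g)
      (((tendsto_inner f g).const_mul (conj c)).congr fun r => ?_)
    simp only [hardyInnerMean, coe_smul, Pi.smul_apply, smul_eq_mul, map_mul, mul_assoc,
      intervalIntegral.integral_const_mul]
    ring
  definite f hf := by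
    have h0 : ∀ r ∈ Ioo (0 : ℝ) 1, hardyMean f r = 0 := fun r hr => by
      refine le_antisymm ?_ (hardyMean_nonneg _ r)
      simpa [hf] using hardyMean_le_lim f.isHardy.1 (tendsto_inner_self f) hr
    refine DFunLike.ext _ _ fun z => ?_
    change f z = 0
    by_cases hz : z ∈ ball (0 : ℂ) 1
    · have hr : (1 / 2 : ℝ) ∈ Ioo (0 : ℝ) 1 := by norm_num
      have hs := hardyMean_hasSum f.isHardy.1 hr
      rw [h0 _ hr, hasSum_zero_iff_of_nonneg (fun n => by positivity)] at hs
      have ha : ∀ n : ℕ, iteratedDeriv n f 0 = 0 := fun n => by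
        simpa [Nat.factorial_ne_zero] using congrFun hs n
      have := hasSum_taylorSeries_on_ball f.isHardy.1 hz
      simp only [ha, smul_zero] at this
      exact this.unique hasSum_zero
    · exact f.isHardy.2 z hz

instance : NormedAddCommGroup HardySpace := core.toNormedAddCommGroup

instance : InnerProductSpace ℂ HardySpace := .ofCore core.toCore

/-- The norm is the one of the classical definition:
`‖f‖² = lim_{r → 1⁻} (1 / 2π) ∫₀^{2π} |f (r e^{iθ})|² dθ`. -/
theorem tendsto_norm_sq (f : HardySpace) :
    Tendsto (hardyMean f) (𝓝[<] 1) (𝓝 (‖f‖ ^ 2)) := by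
  have := tendsto_inner_self f
  rwa [show (inner ℂ f f).re = ‖f‖ ^ 2 from inner_self_eq_norm_sq (𝕜 := ℂ) f] at this

end HardySpace

/-! ### The operators `D_{φ,n}` -/

/-- `φ` is a univalent (analytic and injective) self-map of the unit disk. -/
structure IsUnivalentSelfMap (φ : ℂ → ℂ) : Prop where
  differentiableOn : DifferentiableOn ℂ φ (ball 0 1)
  mapsTo : MapsTo φ (ball 0 1) (ball 0 1)
  injOn : InjOn φ (ball 0 1)

/-- The linear map `T` on `H²` is the operator `D_{φ,n}`, that is, `T f = f⁽ⁿ⁾ ∘ φ` on the unit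
disk for every `f` in `H²`. -/
def IsCompDiff (φ : ℂ → ℂ) (n : ℕ) (T : HardySpace →ₗ[ℂ] HardySpace) : Prop :=
  ∀ f : HardySpace, ∀ z ∈ ball (0 : ℂ) 1, T f z = iteratedDeriv n f (φ z)

/-- `D_{φ,n}` is bounded on `H²`: it maps `H²` into `H²`, and `‖D_{φ,n} f‖ ≤ C ‖f‖`. -/
def CompDiffBounded (φ : ℂ → ℂ) (n : ℕ) : Prop :=
  ∃ T : HardySpace →ₗ[ℂ] HardySpace, IsCompDiff φ n T ∧ ∃ C : ℝ, ∀ f, ‖T f‖ ≤ C * ‖f‖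

/-- `D_{φ,n}` is compact on `H²`: it maps `H²` into `H²`, and it is a compact operator. -/
def CompDiffCompact (φ : ℂ → ℂ) (n : ℕ) : Prop :=
  ∃ T : HardySpace →ₗ[ℂ] HardySpace, IsCompDiff φ n T ∧ IsCompactOperator T

end

/-! Taylor coefficients identify `H²` isometrically with `ℓ²`, and both directions are then
coefficient estimates.

Sufficiency. One half of the Littlewood–Paley identity (`tsum_taylorCoeff_le`) bounds the norm of `g
= f⁽ⁿ⁾ ∘ φ` by `|g(0)|²` and the integral of `|g'|² (1 - |z|²)`, where `g' = (f⁽ⁿ⁺¹⁾ ∘ φ) φ'`. Where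
`1 - |z| ≤ M (1 - |φ(z)|)^(2n+1)`, the weight passes to `φ(z)`. Since `φ` is injective with real
Jacobian `|φ'|²`, the substitution `w = φ(z)` leaves at most the integral of `|f⁽ⁿ⁺¹⁾(w)|² (1 -
|w|²)^(2n+1)` over the disk, which is at most a constant times `‖f‖²`
(`lintegral_iteratedDeriv_le`). This gives boundedness. For compactness, `M` is arbitrarily small
near the unit circle, while on the remaining disk `|z| < ρ` the values `φ(z)` stay in a compact set,
where functions vanishing to order `N` at `0` have small derivatives. Hence `T` is the norm limit of
its compositions with Taylor truncations, which have finite rank.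

Necessity. Evaluation at `w` has norm at most `(1 - |w|²)^(-1/2)`, and `f ↦ f⁽ⁿ⁾(a)` has norm at
least `(1 - |a|²)^(-(2n+1)/2)` (`le_of_norm_iteratedDeriv_le`). Comparing the two at `a = φ(w)`
bounds the ratio. If `T` is compact, `(1 - |w|²) |h(w)|²` tends to `0` uniformly for `h` in a
compact set containing the image of the unit ball, so the ratio tends to `0`. -/

noncomputable section

/-! ### Taylor coefficients of Hardy functions -/

/-- The Taylor coefficients at the origin. -/
def taylorCoeff (f : ℂ → ℂ) (k : ℕ) : ℂ := (k.factorial : ℂ)⁻¹ * iteratedDeriv k f 0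

theorem hasSum_taylorCoeff {f : ℂ → ℂ} (hf : DifferentiableOn ℂ f (ball 0 1)) {z : ℂ}
    (hz : z ∈ ball (0 : ℂ) 1) : HasSum (fun k => taylorCoeff f k * z ^ k) (f z) := by
  have := hasSum_taylorSeries_on_ball hf hz
  simpa [taylorCoeff, mul_assoc, mul_comm, mul_left_comm] using this

theorem taylorCoeff_eq_of_hasSum {f : ℂ → ℂ} {b : ℕ → ℂ}
    (h : ∀ z ∈ ball (0 : ℂ) 1, HasSum (fun k => b k * z ^ k) (f z)) : taylorCoeff f = b := by
  have h1 : HasFPowerSeriesAt f (FormalMultilinearSeries.ofScalars ℂ b) 0 := by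
    rw [hasFPowerSeriesAt_iff]
    filter_upwards [ball_mem_nhds (0 : ℂ) one_pos] with z hz
    simpa [FormalMultilinearSeries.coeff_ofScalars, mul_comm] using h z hz
  have h2 := h1.analyticAt.hasFPowerSeriesAt
  have h3 := h1.eq_formalMultilinearSeries h2
  ext k
  have h4 := congrArg (fun p => FormalMultilinearSeries.coeff p k) h3
  simp only [FormalMultilinearSeries.coeff_ofScalars] at h4
  rw [h4, taylorCoeff, div_eq_inv_mul]

theorem differentiableOn_iteratedDeriv_ball {f : ℂ → ℂ} (hf : DifferentiableOn ℂ f (ball 0 1))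
    (n : ℕ) : DifferentiableOn ℂ (iteratedDeriv n f) (ball 0 1) := by
  induction n with
  | zero => simpa using hf
  | succ n ih =>
    rw [iteratedDeriv_succ]
    exact ih.deriv isOpen_ball

theorem taylorCoeff_iteratedDeriv (f : ℂ → ℂ) (n k : ℕ) :
    taylorCoeff (iteratedDeriv n f) k =
      ((k + n).factorial / k.factorial : ℂ) * taylorCoeff f (k + n) := by
  have h : iteratedDeriv k (iteratedDeriv n f) = iteratedDeriv (k + n) f := by
    simp only [iteratedDeriv_eq_iterate, Function.iterate_add_apply]
  have : ((k + n).factorial : ℂ) ≠ 0 := by exact_mod_cast (k + n).factorial_ne_zero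
  rw [taylorCoeff, taylorCoeff, h]
  field_simp

theorem hardyMean_hasSum_taylorCoeff {f : ℂ → ℂ} (hf : DifferentiableOn ℂ f (ball 0 1)) {r : ℝ}
    (hr : r ∈ Ioo (0 : ℝ) 1) :
    HasSum (fun k : ℕ => ‖taylorCoeff f k‖ ^ 2 * r ^ (2 * k)) (hardyMean f r) :=
  hardyMean_hasSum hf hr

theorem hardyMean_le_tsum {f : ℂ → ℂ} (hf : DifferentiableOn ℂ f (ball 0 1))
    (hs : Summable fun k => ‖taylorCoeff f k‖ ^ 2) {r : ℝ} (hr : r ∈ Ioo (0 : ℝ) 1) :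
    hardyMean f r ≤ ∑' k, ‖taylorCoeff f k‖ ^ 2 := by
  refine hasSum_le (fun k => ?_) (hardyMean_hasSum_taylorCoeff hf hr) hs.hasSum
  exact mul_le_of_le_one_right (by positivity) (pow_le_one₀ hr.1.le hr.2.le)

theorem isHardy_of_summable {f : ℂ → ℂ} (hf : DifferentiableOn ℂ f (ball 0 1))
    (h0 : ∀ z ∉ ball (0 : ℂ) 1, f z = 0) (hs : Summable fun k => ‖taylorCoeff f k‖ ^ 2) :
    IsHardy f :=
  ⟨hf, h0, hardy_exists_lim hf fun _ hr => hardyMean_le_tsum hf hs hr⟩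

/-! ### Isometry of `H²` with `ℓ²`. -/

namespace HardySpace

/-- The Taylor coefficients of an element of `H²`. -/
abbrev coeff (f : HardySpace) (k : ℕ) : ℂ := taylorCoeff f k

theorem differentiableOn (f : HardySpace) : DifferentiableOn ℂ f (ball 0 1) := f.isHardy.1

/-- For a finite sum, Parseval on the circle of radius `r` passes to the limit `r → 1` term by term;
summability of the whole series is then a consequence. -/
theorem sum_coeff_le (f : HardySpace) (s : Finset ℕ) :
    ∑ k ∈ s, ‖f.coeff k‖ ^ 2 ≤ ‖f‖ ^ 2 := by
  have h1 : Tendsto (fun r : ℝ => ∑ k ∈ s, ‖f.coeff k‖ ^ 2 * r ^ (2 * k)) (𝓝[<] 1)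
      (𝓝 (∑ k ∈ s, ‖f.coeff k‖ ^ 2 * 1 ^ (2 * k))) :=
    (Continuous.tendsto (by fun_prop) 1).mono_left nhdsWithin_le_nhds
  simp only [one_pow, mul_one] at h1
  refine le_of_tendsto h1 ?_
  filter_upwards [hardy_nhds] with r hr
  refine le_trans ?_ (hardyMean_le_lim f.differentiableOn f.tendsto_norm_sq hr)
  exact sum_le_hasSum s (fun k _ => mul_nonneg (by positivity) (pow_nonneg hr.1.le _))
    (hardyMean_hasSum_taylorCoeff f.differentiableOn hr)

theorem summable_coeff (f : HardySpace) : Summable fun k => ‖f.coeff k‖ ^ 2 :=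
  summable_of_sum_le (fun _ => by positivity) f.sum_coeff_le

/-- The norm of `H²` is the `ℓ²` norm of the Taylor coefficients. -/
theorem hasSum_coeff (f : HardySpace) : HasSum (fun k => ‖f.coeff k‖ ^ 2) (‖f‖ ^ 2) := by
  have h : ∑' k, ‖f.coeff k‖ ^ 2 = ‖f‖ ^ 2 := by
    refine le_antisymm (f.summable_coeff.tsum_le_of_sum_le f.sum_coeff_le) ?_
    refine le_of_tendsto f.tendsto_norm_sq ?_
    filter_upwards [hardy_nhds] with r hr
    exact hardyMean_le_tsum f.differentiableOn f.summable_coeff hr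
  exact h ▸ f.summable_coeff.hasSum

theorem norm_coeff_le (f : HardySpace) (k : ℕ) : ‖f.coeff k‖ ≤ ‖f‖ := by
  have := f.sum_coeff_le {k}
  simp only [Finset.sum_singleton] at this
  exact (pow_le_pow_iff_left₀ (norm_nonneg _) (norm_nonneg _) two_ne_zero).1 this

theorem hasSum_eval (f : HardySpace) {z : ℂ} (hz : z ∈ ball (0 : ℂ) 1) :
    HasSum (fun k => f.coeff k * z ^ k) (f z) := hasSum_taylorCoeff f.differentiableOn hz

theorem coeff_add (f g : HardySpace) (k : ℕ) : (f + g).coeff k = f.coeff k + g.coeff k := by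
  have := taylorCoeff_eq_of_hasSum (f := ⇑(f + g)) (b := fun k => f.coeff k + g.coeff k)
    fun z hz => by simpa [add_mul, coe_add] using (f.hasSum_eval hz).add (g.hasSum_eval hz)
  exact congrFun this k

theorem coeff_smul (c : ℂ) (f : HardySpace) (k : ℕ) : (c • f).coeff k = c * f.coeff k := by
  have := taylorCoeff_eq_of_hasSum (f := ⇑(c • f)) (b := fun k => c * f.coeff k)
    fun z hz => by simpa [mul_assoc, coe_smul] using (f.hasSum_eval hz).mul_left c
  exact congrFun this k

/-- The power series with coefficients `b` on the unit disk. -/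
def powerSeriesFun (b : ℕ → ℂ) (z : ℂ) : ℂ :=
  (ball (0 : ℂ) 1).indicator (fun z => ∑' k, b k * z ^ k) z

theorem summable_mul_pow_of_bounded {b : ℕ → ℂ} {C : ℝ} (hb : ∀ k, ‖b k‖ ≤ C) {r : ℝ}
    (hr : r ∈ Ico (0 : ℝ) 1) : Summable fun k => ‖b k‖ * r ^ k :=
  Summable.of_nonneg_of_le (fun _ => mul_nonneg (norm_nonneg _) (pow_nonneg hr.1 _))
    (fun k => mul_le_mul_of_nonneg_right (hb k) (pow_nonneg hr.1 _))
    ((summable_geometric_of_lt_one hr.1 hr.2).mul_left C)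

theorem bounded_of_summable_sq {b : ℕ → ℂ} (hb : Summable fun k => ‖b k‖ ^ 2) :
    ∀ k, ‖b k‖ ≤ √(∑' j, ‖b j‖ ^ 2) := fun k =>
  Real.le_sqrt_of_sq_le (hb.le_tsum k fun _ _ => by positivity)

theorem hasSum_powerSeriesFun {b : ℕ → ℂ} (hb : Summable fun k => ‖b k‖ ^ 2) {z : ℂ}
    (hz : z ∈ ball (0 : ℂ) 1) : HasSum (fun k => b k * z ^ k) (powerSeriesFun b z) := by
  rw [powerSeriesFun, indicator_of_mem hz]
  refine Summable.hasSum (Summable.of_norm ?_)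
  simpa using summable_mul_pow_of_bounded (bounded_of_summable_sq hb)
    (r := ‖z‖) ⟨norm_nonneg _, by simpa using hz⟩

theorem differentiableOn_powerSeriesFun {b : ℕ → ℂ} (hb : Summable fun k => ‖b k‖ ^ 2) :
    DifferentiableOn ℂ (powerSeriesFun b) (ball 0 1) := by
  have h : DifferentiableOn ℂ (fun z => ∑' k, b k * z ^ k) (ball 0 1) := by
    intro z hz
    obtain ⟨r, hzr, hr⟩ := exists_between (mem_ball_zero_iff.1 hz)
    have hd : DifferentiableOn ℂ (fun z => ∑' k, b k * z ^ k) (ball 0 r) := by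
      refine differentiableOn_tsum_of_summable_norm
        (summable_mul_pow_of_bounded (bounded_of_summable_sq hb)
          (r := r) ⟨(norm_nonneg _).trans hzr.le, hr⟩)
        (fun k => (by fun_prop : Differentiable ℂ fun z : ℂ => b k * z ^ k).differentiableOn)
        isOpen_ball fun k w hw => ?_
      rw [norm_mul, norm_pow]
      gcongr
      exact (mem_ball_zero_iff.1 hw).le
    exact (hd.differentiableAt (isOpen_ball.mem_nhds
      (mem_ball_zero_iff.2 hzr))).differentiableWithinAt
  exact h.congr fun z hz => by rw [powerSeriesFun, indicator_of_mem hz]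

/-- The element of `H²` with given square summable Taylor coefficients. -/
def ofCoeff (b : ℕ → ℂ) (hb : Summable fun k => ‖b k‖ ^ 2) : HardySpace :=
  ⟨powerSeriesFun b, isHardy_of_summable (differentiableOn_powerSeriesFun hb)
    (fun z hz => by rw [powerSeriesFun, indicator_of_notMem hz])
    (by rwa [taylorCoeff_eq_of_hasSum fun z hz => hasSum_powerSeriesFun hb hz])⟩

theorem coeff_ofCoeff (b : ℕ → ℂ) (hb : Summable fun k => ‖b k‖ ^ 2) (k : ℕ) :
    (ofCoeff b hb).coeff k = b k :=
  congrFun (taylorCoeff_eq_of_hasSum fun _ hz => hasSum_powerSeriesFun hb hz) k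

/-- The coefficient isometry onto `ℓ²`. -/
def coeffIsometry : HardySpace →ₗᵢ[ℂ] lp (fun _ : ℕ => ℂ) 2 where
  toFun f := ⟨f.coeff, memℓp_gen (by simpa using f.summable_coeff)⟩
  map_add' f g := by ext k; exact coeff_add f g k
  map_smul' c f := by ext k; exact coeff_smul c f k
  norm_map' f := by
    have h := lp.norm_rpow_eq_tsum (p := 2) (by simp)
      (⟨f.coeff, memℓp_gen (by simpa using f.summable_coeff)⟩ : lp (fun _ : ℕ => ℂ) 2)
    simp only [ENNReal.toReal_ofNat, Real.rpow_ofNat, f.hasSum_coeff.tsum_eq] at h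
    exact (pow_left_inj₀ (norm_nonneg _) (norm_nonneg _) two_ne_zero).1 h

/-- Completeness is what makes a norm limit of compact operators compact. -/
instance : CompleteSpace HardySpace := by
  have hs : Function.Surjective coeffIsometry := fun b => by
    have hb : Summable fun k => ‖b k‖ ^ 2 := by simpa using (lp.memℓp b).summable (by simp)
    exact ⟨ofCoeff b hb, by ext k; exact coeff_ofCoeff b hb k⟩
  exact (coeffIsometry.isometry.isUniformInducing.completeSpace_congr hs).2 inferInstance

end HardySpace

namespace HardySpace

/-! ### Point evaluations and truncations -/

/-- Cauchy–Schwarz for the partial sums of the power series against the geometric series in `|w|²`.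
-/
theorem norm_sq_eval_le (f : HardySpace) {w : ℂ} (hw : w ∈ ball (0 : ℂ) 1) :
    (1 - ‖w‖ ^ 2) * ‖f w‖ ^ 2 ≤ ‖f‖ ^ 2 := by
  have hw1 : ‖w‖ < 1 := mem_ball_zero_iff.1 hw
  have hw2 : ‖w‖ ^ 2 < 1 := pow_lt_one₀ (norm_nonneg _) hw1 two_ne_zero
  have hg := hasSum_geometric_of_lt_one (sq_nonneg ‖w‖) hw2
  have hlim := ((f.hasSum_eval hw).tendsto_sum_nat.norm.pow 2).const_mul (1 - ‖w‖ ^ 2)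
  refine le_of_tendsto hlim (.of_forall fun N => ?_)
  have h1 : ‖∑ k ∈ Finset.range N, f.coeff k * w ^ k‖ ^ 2 ≤ ‖f‖ ^ 2 * (1 - ‖w‖ ^ 2)⁻¹ := by
    calc ‖∑ k ∈ Finset.range N, f.coeff k * w ^ k‖ ^ 2
        ≤ (∑ k ∈ Finset.range N, ‖f.coeff k‖ * ‖w‖ ^ k) ^ 2 := by
          gcongr
          refine (norm_sum_le _ _).trans_eq (Finset.sum_congr rfl fun k _ => ?_)
          rw [norm_mul, norm_pow]
      _ ≤ (∑ k ∈ Finset.range N, ‖f.coeff k‖ ^ 2) * ∑ k ∈ Finset.range N, (‖w‖ ^ k) ^ 2 :=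
          Finset.sum_mul_sq_le_sq_mul_sq _ _ _
      _ ≤ ‖f‖ ^ 2 * (1 - ‖w‖ ^ 2)⁻¹ := by
          refine mul_le_mul (f.sum_coeff_le _) ?_ (by positivity) (by positivity)
          refine le_trans (le_of_eq ?_) (sum_le_hasSum (Finset.range N) (fun _ _ => by positivity) hg)
          exact Finset.sum_congr rfl fun k _ => by rw [← pow_mul, ← pow_mul, mul_comm]
  have hp : 0 < 1 - ‖w‖ ^ 2 := by linarith
  rwa [← div_eq_mul_inv, le_div_iff₀' hp] at h1

theorem norm_eval_le_of_coeff_eq_zero {f : HardySpace} {N : ℕ} (hN : ∀ k < N, f.coeff k = 0)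
    {R : ℝ} (hR : R < 1) {z : ℂ} (hz : ‖z‖ ≤ R) : ‖f z‖ ≤ ‖f‖ * R ^ N * (1 - R)⁻¹ := by
  have hR0 : 0 ≤ R := (norm_nonneg z).trans hz
  have h1 := (hasSum_nat_add_iff' N).2 (f.hasSum_eval (mem_ball_zero_iff.2 (hz.trans_lt hR)))
  rw [Finset.sum_eq_zero fun k hk => by rw [hN k (Finset.mem_range.1 hk), zero_mul],
    sub_zero] at h1
  refine h1.norm_le_of_bounded
    ((hasSum_geometric_of_lt_one hR0 hR).mul_left (‖f‖ * R ^ N)) fun k => ?_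
  rw [norm_mul, norm_pow, mul_assoc, ← pow_add, add_comm N k]
  exact mul_le_mul (f.norm_coeff_le _) (pow_le_pow_left₀ (norm_nonneg _) hz _) (by positivity)
    (norm_nonneg _)

/-- Cauchy's estimate on circles of radius `R - r`, with `R` halfway between `r` and `1`; on `|z| ≤
R` a function vanishing to order `N` is `O(R ^ N)`. The case `N = 0` is the plain bound for
derivatives on a compact disk. -/
theorem exists_tendsto_norm_iteratedDeriv_le (m : ℕ) {r : ℝ} (hr0 : 0 ≤ r) (hr : r < 1) :
    ∃ ε : ℕ → ℝ, Tendsto ε atTop (𝓝 0) ∧ (∀ N, 0 ≤ ε N) ∧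
      ∀ N, ∀ f : HardySpace, (∀ k < N, f.coeff k = 0) → ∀ z : ℂ, ‖z‖ ≤ r →
        ‖iteratedDeriv m f z‖ ≤ ε N * ‖f‖ := by
  set R : ℝ := (1 + r) / 2 with hRdef
  have hR : R < 1 := by linarith
  have hrR : 0 < R - r := by linarith
  have hR0 : 0 < R := by linarith
  have hR1 : 0 < 1 - R := by linarith
  refine ⟨fun N => m.factorial * (R ^ N * (1 - R)⁻¹) / (R - r) ^ m, ?_, fun N => by positivity, ?_⟩
  · have := (((tendsto_pow_atTop_nhds_zero_of_lt_one hR0.le hR).mul_const (1 - R)⁻¹).const_mul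
      (m.factorial : ℝ)).div_const ((R - r) ^ m)
    simpa using this
  · intro N f hf z hz
    have hsub : closedBall z (R - r) ⊆ ball (0 : ℂ) 1 := fun x hx => by
      have h1 := mem_closedBall_iff_norm.1 hx
      have h2 := norm_le_norm_add_norm_sub' x z
      rw [mem_ball_zero_iff]
      linarith
    have hd : DiffContOnCl ℂ f (ball z (R - r)) :=
      (f.differentiableOn.mono hsub).diffContOnCl_ball subset_rfl
    have := norm_iteratedDeriv_le_of_forall_mem_sphere_norm_le m hrR hd
      (C := ‖f‖ * R ^ N * (1 - R)⁻¹) fun x hx => by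
        refine norm_eval_le_of_coeff_eq_zero hf hR ?_
        have h1 := mem_sphere_iff_norm.1 hx
        have h2 := norm_le_norm_add_norm_sub' x z
        linarith
    refine this.trans_eq ?_
    ring

/-- The coefficient functionals. -/
def coeffL (k : ℕ) : HardySpace →L[ℂ] ℂ :=
  LinearMap.mkContinuous
    { toFun := fun f => f.coeff k
      map_add' := fun f g => coeff_add f g k
      map_smul' := fun c f => coeff_smul c f k } 1
    fun f => by simpa using f.norm_coeff_le k

theorem coeffL_apply (k : ℕ) (f : HardySpace) : coeffL k f = f.coeff k := rfl

/-- The monomials in `H²`. -/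
def monomial (k : ℕ) : HardySpace :=
  ofCoeff (Pi.single k 1) (summable_of_ne_finset_zero (s := {k}) fun j hj => by
    simp [Pi.single_eq_of_ne (Finset.notMem_singleton.1 hj)])

theorem coeff_monomial (k j : ℕ) : (monomial k).coeff j = if j = k then 1 else 0 := by
  rw [monomial, coeff_ofCoeff, Pi.single_apply]

/-- The Taylor polynomials as operators on `H²`. -/
def truncL (N : ℕ) : HardySpace →L[ℂ] HardySpace :=
  ∑ k ∈ Finset.range N, (coeffL k).smulRight (monomial k)

theorem coeff_truncL (N : ℕ) (f : HardySpace) (j : ℕ) :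
    (truncL N f).coeff j = if j < N then f.coeff j else 0 := by
  rw [← coeffL_apply, truncL, _root_.sum_apply, map_sum]
  simp [coeffL_apply, coeff_monomial]

theorem coeff_sub_truncL (N : ℕ) (f : HardySpace) (j : ℕ) :
    (f - truncL N f).coeff j = if j < N then 0 else f.coeff j := by
  rw [← coeffL_apply, map_sub, coeffL_apply, coeffL_apply, coeff_truncL]
  split_ifs <;> simp

theorem norm_sub_truncL_le (N : ℕ) (f : HardySpace) : ‖f - truncL N f‖ ≤ ‖f‖ := by
  refine (pow_le_pow_iff_left₀ (norm_nonneg _) (norm_nonneg _) two_ne_zero).1 ?_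
  refine hasSum_le (fun k => ?_) (f - truncL N f).hasSum_coeff f.hasSum_coeff
  rw [coeff_sub_truncL]
  split_ifs <;> simp

theorem tendsto_norm_sub_truncL (f : HardySpace) :
    Tendsto (fun N => ‖f - truncL N f‖ ^ 2) atTop (𝓝 0) := by
  have h : ∀ N, ‖f - truncL N f‖ ^ 2 = ‖f‖ ^ 2 - ∑ k ∈ Finset.range N, ‖f.coeff k‖ ^ 2 := fun N => by
    have h1 := (hasSum_nat_add_iff' N).2 (f - truncL N f).hasSum_coeff
    have h2 := (hasSum_nat_add_iff' N).2 f.hasSum_coeff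
    rw [Finset.sum_eq_zero fun k hk => by simp [coeff_sub_truncL, Finset.mem_range.1 hk],
      sub_zero] at h1
    simp only [coeff_sub_truncL, not_lt.2 (Nat.le_add_left N _), if_false] at h1
    exact h1.unique h2
  simp only [h]
  have := f.hasSum_coeff.tendsto_sum_nat.const_sub (‖f‖ ^ 2)
  rwa [sub_self] at this

theorem isCompactOperator_comp_truncL (T : HardySpace →L[ℂ] HardySpace) (N : ℕ) :
    IsCompactOperator (T ∘L truncL N) := by
  refine IsCompactOperator.clm_comp ?_ T
  rw [truncL]
  induction N with
  | zero => exact isCompactOperator_zero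
  | succ N ih =>
    rw [Finset.sum_range_succ]
    refine ih.add ?_
    exact (isCompactOperator_of_locallyCompactSpace_dom (coeffL N)).clm_comp
      ((1 : ℂ →L[ℂ] ℂ).smulRight (monomial N))

end HardySpace

/-! ### Weighted area integrals -/

/-- This is half the Beta integral `B(k + 1, m + 1)`. The function `r ^ (2k+2) (1 - r²) ^ (m+1)`
vanishes at both ends, so integrating its derivative trades a factor `1 - r²` for a factor `r²`;
hence the induction on `m` with `k` free. -/
theorem integral_pow_mul_one_sub_sq_pow (k m : ℕ) :
    ∫ r in (0 : ℝ)..1, r ^ (2 * k + 1) * (1 - r ^ 2) ^ m =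
      (k.factorial * m.factorial / (2 * (k + m + 1).factorial) : ℝ) := by
  induction m generalizing k with
  | zero =>
    simp only [pow_zero, mul_one, integral_pow, Nat.factorial_zero, add_zero, Nat.factorial_succ]
    have := k.factorial_ne_zero
    push_cast
    field_simp
    simp
    ring
  | succ m ih =>
    have hF : ∀ r : ℝ, HasDerivAt (fun r : ℝ => r ^ (2 * k + 2) * (1 - r ^ 2) ^ (m + 1))
        ((2 * k + 2) * (r ^ (2 * k + 1) * (1 - r ^ 2) ^ (m + 1)) -
          2 * (m + 1) * (r ^ (2 * (k + 1) + 1) * (1 - r ^ 2) ^ m)) r := fun r => by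
      have h1 := (hasDerivAt_pow (2 * k + 2) r).mul
        (((hasDerivAt_pow 2 r).const_sub 1).pow (m + 1))
      refine h1.congr_deriv ?_
      push_cast
      simp
      ring
    have h := intervalIntegral.integral_eq_sub_of_hasDerivAt (a := 0) (b := 1) (fun r _ => hF r)
      (Continuous.intervalIntegrable (by fun_prop) _ _)
    rw [intervalIntegral.integral_sub (Continuous.intervalIntegrable (by fun_prop) _ _)
      (Continuous.intervalIntegrable (by fun_prop) _ _), intervalIntegral.integral_const_mul,
      intervalIntegral.integral_const_mul, ih (k + 1)] at h
    simp only [one_pow, sub_self, ne_eq, Nat.add_eq_zero_iff, one_ne_zero, and_false,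
      not_false_eq_true, zero_pow, mul_zero, zero_mul, OfNat.ofNat_ne_zero, sub_zero] at h
    have h2 : (2 * k + 2 : ℝ) ≠ 0 := by positivity
    rw [show k + 1 + m + 1 = k + (m + 1) + 1 by ring] at h
    apply mul_left_cancel₀ h2
    rw [sub_eq_zero.1 h, Nat.factorial_succ k, Nat.factorial_succ m]
    push_cast
    ring

theorem lintegral_circle_norm_sq {g : ℂ → ℂ} (hg : DifferentiableOn ℂ g (ball 0 1)) {r : ℝ}
    (hr : r ∈ Ioo (0 : ℝ) 1) :
    ∫⁻ θ in Ioo (-π) π, ENNReal.ofReal (‖g (r * exp (θ * I))‖ ^ 2) =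
      ENNReal.ofReal (2 * π * hardyMean g r) := by
  have hc : Continuous fun θ : ℝ => ‖g (r * exp (θ * I))‖ ^ 2 :=
    (hardy_continuous hg ⟨hr.1.le, hr.2⟩).norm.pow 2
  have hper : Function.Periodic (fun θ : ℝ => ‖g (r * exp (θ * I))‖ ^ 2) (2 * π) := fun θ => by
    have : exp ((θ + 2 * π : ℝ) * I) = exp (θ * I) := by
      push_cast
      rw [add_mul, exp_periodic]
    simp only [this]
  rw [MeasureTheory.Measure.restrict_congr_set MeasureTheory.Ioo_ae_eq_Ioc,
    ← MeasureTheory.ofReal_integral_eq_lintegral_ofReal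
      (hc.integrableOn_Ioc) (.of_forall fun _ => by positivity),
    ← intervalIntegral.integral_of_le (by linarith [pi_pos])]
  congr 1
  have h := hper.intervalIntegral_add_eq (-π) 0
  rw [show -π + 2 * π = π by ring, zero_add] at h
  rw [h, hardyMean, ← mul_assoc, mul_inv_cancel₀ two_pi_pos.ne', one_mul]

/-- In polar coordinates, Parseval on each circle removes the cross terms and the Beta integral
evaluates the radial part. With values in `ENNReal`, sum and integral commute without any
convergence assumption. -/
theorem lintegral_ball_norm_sq_mul_weight {g : ℂ → ℂ} (hg : DifferentiableOn ℂ g (ball 0 1))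
    (m : ℕ) :
    ∫⁻ z in ball (0 : ℂ) 1, ENNReal.ofReal (‖g z‖ ^ 2 * (1 - ‖z‖ ^ 2) ^ m) =
      ∑' k : ℕ, ENNReal.ofReal (π * ‖taylorCoeff g k‖ ^ 2 *
        (k.factorial * m.factorial / (k + m + 1).factorial)) := by
  have hcont : ContinuousOn (fun z : ℂ => ENNReal.ofReal (‖g z‖ ^ 2 * (1 - ‖z‖ ^ 2) ^ m))
      (ball 0 1) := by
    have := hg.continuousOn
    refine ENNReal.continuous_ofReal.comp_continuousOn ?_
    fun_prop
  -- The polar coordinate formula and Tonelli's theorem need a measurable function on the whole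
  -- plane, hence the extension by zero.
  set F : ℂ → ENNReal :=
    (ball (0 : ℂ) 1).indicator fun z => ENNReal.ofReal (‖g z‖ ^ 2 * (1 - ‖z‖ ^ 2) ^ m) with hF
  have hFm : Measurable F := by
    refine measurable_of_restrict_of_restrict_compl (s := ball (0 : ℂ) 1) measurableSet_ball ?_ ?_
    · have : (ball (0 : ℂ) 1).domRestrict F = (ball (0 : ℂ) 1).domRestrict fun z =>
        ENNReal.ofReal (‖g z‖ ^ 2 * (1 - ‖z‖ ^ 2) ^ m) := by
        ext z; simp [hF]
      rw [this]
      exact (continuousOn_iff_continuous_domRestrict.1 hcont).measurable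
    · have : (ball (0 : ℂ) 1)ᶜ.domRestrict F = fun _ => 0 := by
        ext z
        change F z = 0
        rw [hF]
        exact indicator_of_notMem z.2 _
      rw [this]
      exact measurable_const
  have hpol : ∀ r θ : ℝ, Complex.polarCoord.symm (r, θ) = r * exp (θ * I) := fun r θ => by
    rw [Complex.polarCoord_symm_apply, exp_mul_I]
    push_cast
    rfl
  have hinner : ∀ r ∈ Ioi (0 : ℝ),
      ∫⁻ θ in Ioo (-π) π, ENNReal.ofReal r * F (Complex.polarCoord.symm (r, θ)) =
      (Ioo (0 : ℝ) 1).indicator (fun r => ∑' k : ℕ, ENNReal.ofReal (2 * π *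
        ‖taylorCoeff g k‖ ^ 2 * (r ^ (2 * k + 1) * (1 - r ^ 2) ^ m))) r := by
    intro r hr
    have hr0 : 0 < r := hr
    by_cases hr1 : r < 1
    · have hw : 0 ≤ (1 - r ^ 2) ^ m := pow_nonneg (by nlinarith) _
      rw [indicator_of_mem (show r ∈ Ioo (0 : ℝ) 1 from ⟨hr0, hr1⟩)]
      have h1 : ∀ θ : ℝ, ENNReal.ofReal r * F (Complex.polarCoord.symm (r, θ)) =
          ENNReal.ofReal (r * (1 - r ^ 2) ^ m) *
            ENNReal.ofReal (‖g (r * exp (θ * I))‖ ^ 2) := fun θ => by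
        rw [hF, hpol, indicator_of_mem (hardy_circle_mem ⟨hr0.le, hr1⟩ θ),
          ← ENNReal.ofReal_mul hr0.le, ← ENNReal.ofReal_mul (by positivity)]
        congr 1
        simp only [norm_mul, norm_exp_ofReal_mul_I, norm_real, mul_one, Real.norm_eq_abs, sq_abs]
        ring
      have h2 := (hardyMean_hasSum_taylorCoeff hg ⟨hr0, hr1⟩).mul_left
        (r * (1 - r ^ 2) ^ m * (2 * π))
      simp only [h1]
      rw [MeasureTheory.lintegral_const_mul' _ _ ENNReal.ofReal_ne_top,
        lintegral_circle_norm_sq hg ⟨hr0, hr1⟩, ← ENNReal.ofReal_mul (by positivity),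
        ← mul_assoc, ← h2.tsum_eq, ENNReal.ofReal_tsum_of_nonneg (fun k => by positivity)
          h2.summable]
      refine tsum_congr fun k => ?_
      congr 1
      ring
    · rw [indicator_of_notMem fun h => hr1 h.2]
      have h1 : ∀ θ : ℝ, F (Complex.polarCoord.symm (r, θ)) = 0 := fun θ => by
        rw [hF, hpol, indicator_of_notMem]
        simpa [norm_exp_ofReal_mul_I, abs_of_pos hr0] using hr1
      simp only [h1, mul_zero, MeasureTheory.lintegral_zero]
  calc ∫⁻ z in ball (0 : ℂ) 1, ENNReal.ofReal (‖g z‖ ^ 2 * (1 - ‖z‖ ^ 2) ^ m)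
      = ∫⁻ z, F z := (MeasureTheory.lintegral_indicator measurableSet_ball _).symm
    _ = ∫⁻ r in Ioi (0 : ℝ), ∫⁻ θ in Ioo (-π) π,
          ENNReal.ofReal r * F (Complex.polarCoord.symm (r, θ)) := by
        rw [← Complex.lintegral_comp_polarCoord_symm, polarCoord_target,
          MeasureTheory.Measure.volume_eq_prod, ← MeasureTheory.Measure.prod_restrict,
          MeasureTheory.lintegral_prod]
        · rfl
        · refine (Measurable.mul (by fun_prop) (hFm.comp ?_)).aemeasurable
          have : ⇑Complex.polarCoord.symm =
              fun p : ℝ × ℝ => (p.1 * exp (p.2 * I) : ℂ) := funext fun p => hpol p.1 p.2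
          rw [this]
          fun_prop
    _ = ∫⁻ r in Ioo (0 : ℝ) 1, ∑' k : ℕ, ENNReal.ofReal (2 * π *
          ‖taylorCoeff g k‖ ^ 2 * (r ^ (2 * k + 1) * (1 - r ^ 2) ^ m)) := by
        rw [MeasureTheory.setLIntegral_congr_fun measurableSet_Ioi hinner,
          MeasureTheory.setLIntegral_indicator measurableSet_Ioo,
          inter_eq_left.2 fun r hr => hr.1]
    _ = ∑' k : ℕ, ∫⁻ r in Ioo (0 : ℝ) 1, ENNReal.ofReal (2 * π *
          ‖taylorCoeff g k‖ ^ 2 * (r ^ (2 * k + 1) * (1 - r ^ 2) ^ m)) :=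
        MeasureTheory.lintegral_tsum fun k => by fun_prop
    _ = _ := tsum_congr fun k => by
        have hc : Continuous fun r : ℝ => 2 * π * ‖taylorCoeff g k‖ ^ 2 *
          (r ^ (2 * k + 1) * (1 - r ^ 2) ^ m) := by fun_prop
        rw [← MeasureTheory.ofReal_integral_eq_lintegral_ofReal
          (hc.integrableOn_Ioc.mono_set Ioo_subset_Ioc_self)
          (MeasureTheory.ae_restrict_of_forall_mem measurableSet_Ioo fun r hr => by
            have : 0 ≤ (1 - r ^ 2) ^ m := pow_nonneg (by nlinarith [hr.1, hr.2]) _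
            have := hr.1.le
            simp only [Pi.zero_apply]
            positivity),
          ← MeasureTheory.integral_Ioc_eq_integral_Ioo,
          ← intervalIntegral.integral_of_le zero_le_one, intervalIntegral.integral_const_mul,
          integral_pow_mul_one_sub_sq_pow]
        congr 1
        field_simp

theorem taylorCoeff_zero (f : ℂ → ℂ) : taylorCoeff f 0 = f 0 := by simp [taylorCoeff]

/-- One half of the Littlewood–Paley identity. -/
theorem tsum_taylorCoeff_le {g : ℂ → ℂ} (hg : DifferentiableOn ℂ g (ball 0 1)) :
    ∑' k, ENNReal.ofReal (‖taylorCoeff g k‖ ^ 2) ≤ ENNReal.ofReal (‖g 0‖ ^ 2) +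
      ENNReal.ofReal (2 / π) *
        ∫⁻ z in ball (0 : ℂ) 1, ENNReal.ofReal (‖deriv g z‖ ^ 2 * (1 - ‖z‖ ^ 2)) := by
  have h := lintegral_ball_norm_sq_mul_weight (hg.deriv isOpen_ball) 1
  simp only [pow_one] at h
  rw [h, tsum_eq_zero_add' ENNReal.summable, taylorCoeff_zero, ← ENNReal.tsum_mul_left]
  gcongr with k
  rw [← ENNReal.ofReal_mul (by positivity), ← iteratedDeriv_one, taylorCoeff_iteratedDeriv]
  apply ENNReal.ofReal_le_ofReal
  have h1 : (k.factorial : ℝ) ≠ 0 := by exact_mod_cast k.factorial_ne_zero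
  rw [norm_mul, mul_pow]
  have h2 : ‖((k + 1).factorial / k.factorial : ℂ)‖ = k + 1 := by
    have h3 : ((k + 1).factorial / k.factorial : ℂ) = ((k + 1 : ℕ) : ℂ) := by
      rw [Nat.factorial_succ, Nat.cast_mul, mul_div_assoc, div_self, mul_one]
      exact_mod_cast h1
    rw [h3, Complex.norm_natCast]
    push_cast
    rfl
  have h4 : (k.factorial * Nat.factorial 1 / (k + 1 + 1).factorial : ℝ) =
      1 / ((k + 1) * (k + 2)) := by
    rw [Nat.factorial_succ (k + 1), Nat.factorial_succ k]
    push_cast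
    field_simp
    simp
    ring
  -- The factor `2 (k + 1) / (k + 2)` equals `1` at `k = 0` and increases with `k`, which is why the
  -- constant `2 / π` suffices.
  have h5 : 2 / π * (π * ((k + 1 : ℝ) ^ 2 * ‖taylorCoeff g (k + 1)‖ ^ 2) *
      (1 / ((k + 1) * (k + 2)))) = ‖taylorCoeff g (k + 1)‖ ^ 2 * (2 * (k + 1) / (k + 2)) := by
    field_simp
  rw [h2, h4, h5]
  refine le_mul_of_one_le_right (by positivity) ?_
  rw [one_le_div (by positivity)]
  linarith [(Nat.cast_nonneg k : (0 : ℝ) ≤ k)]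

/-- Log-convexity of the factorial, at the midpoint `k + N` of `k` and `k + 2N`. -/
theorem factorial_add_sq_le (k N : ℕ) :
    (k + N).factorial ^ 2 ≤ k.factorial * (k + 2 * N).factorial := by
  induction N with
  | zero => simp [sq]
  | succ N ih =>
    rw [show k + 2 * (N + 1) = (k + 2 * N + 1) + 1 by ring, ← add_assoc, Nat.factorial_succ,
      Nat.factorial_succ (k + 2 * N + 1), Nat.factorial_succ (k + 2 * N)]
    calc ((k + N + 1) * (k + N).factorial) ^ 2
        = (k + N + 1) ^ 2 * (k + N).factorial ^ 2 := by ring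
      _ ≤ ((k + 2 * N + 1 + 1) * (k + 2 * N + 1)) * (k.factorial * (k + 2 * N).factorial) :=
          Nat.mul_le_mul (by nlinarith) ih
      _ = _ := by ring

/-- The exponent `2n + 1` exactly compensates `n + 1` derivatives: the coefficient of index `k + n +
1` is weighted by `π (2n+1)! (k+n+1)!² / (k! (k+2n+2)!)`, and the last quotient is at most `1` by
`factorial_add_sq_le`. -/
theorem HardySpace.lintegral_iteratedDeriv_le (f : HardySpace) (n : ℕ) :
    ∫⁻ w in ball (0 : ℂ) 1,
        ENNReal.ofReal (‖iteratedDeriv (n + 1) f w‖ ^ 2 * (1 - ‖w‖ ^ 2) ^ (2 * n + 1)) ≤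
      ENNReal.ofReal (π * (2 * n + 1).factorial * ‖f‖ ^ 2) := by
  rw [lintegral_ball_norm_sq_mul_weight (differentiableOn_iteratedDeriv_ball f.differentiableOn _)]
  have hs := ((summable_nat_add_iff (n + 1)).2 f.summable_coeff)
  have h1 : ∑' k, ‖f.coeff (k + (n + 1))‖ ^ 2 ≤ ‖f‖ ^ 2 := by
    rw [← f.hasSum_coeff.tsum_eq, ← f.summable_coeff.sum_add_tsum_nat_add (n + 1)]
    exact le_add_of_nonneg_left (Finset.sum_nonneg fun _ _ => by positivity)
  calc _ ≤ ∑' k, ENNReal.ofReal (π * (2 * n + 1).factorial * ‖f.coeff (k + (n + 1))‖ ^ 2) := by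
        refine ENNReal.tsum_le_tsum fun k => ENNReal.ofReal_le_ofReal ?_
        rw [taylorCoeff_iteratedDeriv, norm_mul, norm_div, Complex.norm_natCast, Complex.norm_natCast]
        have h2 : ((k + (n + 1)).factorial : ℝ) ^ 2 ≤
            k.factorial * (k + 2 * (n + 1)).factorial := by
          exact_mod_cast factorial_add_sq_le k (n + 1)
        have h3 : (k.factorial : ℝ) ≠ 0 := by exact_mod_cast k.factorial_ne_zero
        rw [show k + (2 * n + 1) + 1 = k + 2 * (n + 1) by ring]
        have h4 : (0 : ℝ) < k.factorial * (k + 2 * (n + 1)).factorial := by positivity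
        calc _ = π * (2 * n + 1).factorial * ‖f.coeff (k + (n + 1))‖ ^ 2 *
              ((k + (n + 1)).factorial ^ 2 / (k.factorial * (k + 2 * (n + 1)).factorial)) := by
              field_simp
          _ ≤ _ := mul_le_of_le_one_right (by positivity) ((div_le_one h4).2 h2)
    _ = ENNReal.ofReal (π * (2 * n + 1).factorial * ∑' k, ‖f.coeff (k + (n + 1))‖ ^ 2) := by
        rw [← tsum_mul_left, ENNReal.ofReal_tsum_of_nonneg (fun k => by positivity)
          (hs.mul_left _)]
    _ ≤ _ := by gcongr

/-! ### Change of variables under a univalent map. -/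

namespace IsUnivalentSelfMap

theorem hasDerivAt {φ : ℂ → ℂ} (hφ : IsUnivalentSelfMap φ) {z : ℂ} (hz : z ∈ ball (0 : ℂ) 1) :
    HasDerivAt φ (deriv φ z) z :=
  (hφ.differentiableOn.differentiableAt (isOpen_ball.mem_nhds hz)).hasDerivAt

theorem norm_lt_one {φ : ℂ → ℂ} (hφ : IsUnivalentSelfMap φ) {z : ℂ} (hz : z ∈ ball (0 : ℂ) 1) :
    ‖φ z‖ < 1 := mem_ball_zero_iff.1 (hφ.mapsTo hz)

/-- Change of variables for univalent functions. -/
theorem lintegral_comp_le {φ : ℂ → ℂ} (hφ : IsUnivalentSelfMap φ) {s : Set ℂ}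
    (hs : MeasurableSet s) (hs1 : s ⊆ ball 0 1) (G : ℂ → ENNReal) :
    ∫⁻ z in s, ENNReal.ofReal (‖deriv φ z‖ ^ 2) * G (φ z) ≤ ∫⁻ w in ball (0 : ℂ) 1, G w := by
  have h := MeasureTheory.lintegral_image_eq_lintegral_abs_det_fderiv_mul MeasureTheory.volume hs
    (fun z hz => ((hφ.hasDerivAt (hs1 hz)).hasFDerivAt.restrictScalars ℝ).hasFDerivWithinAt)
    (hφ.injOn.mono hs1) G
  -- The real determinant of multiplication by `c` is the field norm of `ℂ` over `ℝ`.
  have hdet : ∀ c : ℂ, |((ContinuousLinearMap.toSpanSingleton ℂ c).restrictScalars ℝ).det| =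
      ‖c‖ ^ 2 := fun c => by
    have : ((ContinuousLinearMap.toSpanSingleton ℂ c).restrictScalars ℝ).det =
        Algebra.norm ℝ c := by
      rw [Algebra.norm_apply]
      exact congrArg LinearMap.det (LinearMap.ext fun x => by simp [mul_comm])
    rw [this, Algebra.norm_complex_apply, normSq_eq_norm_sq, abs_of_nonneg (by positivity)]
  simp only [hdet] at h
  rw [← h]
  exact MeasureTheory.lintegral_mono_set ((hφ.mapsTo.mono_left hs1).image_subset)

end IsUnivalentSelfMap

/-- The function `f⁽ⁿ⁾ ∘ φ` on the disk, extended by zero. -/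
def compDiffFun (φ : ℂ → ℂ) (n : ℕ) (f : ℂ → ℂ) : ℂ → ℂ :=
  (ball (0 : ℂ) 1).indicator fun z => iteratedDeriv n f (φ z)

/-! ### Norm estimates for `f⁽ⁿ⁾ ∘ φ`. -/

section CompDiff

theorem compDiffFun_apply (φ : ℂ → ℂ) (n : ℕ) (f : ℂ → ℂ) {z : ℂ} (hz : z ∈ ball (0 : ℂ) 1) :
    compDiffFun φ n f z = iteratedDeriv n f (φ z) := indicator_of_mem hz _

theorem differentiableOn_compDiffFun {φ : ℂ → ℂ} (hφ : IsUnivalentSelfMap φ) (n : ℕ) {f : ℂ → ℂ}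
    (hf : DifferentiableOn ℂ f (ball 0 1)) :
    DifferentiableOn ℂ (compDiffFun φ n f) (ball 0 1) :=
  ((differentiableOn_iteratedDeriv_ball hf n).comp hφ.differentiableOn hφ.mapsTo).congr
    fun _ hz => compDiffFun_apply φ n f hz

theorem deriv_compDiffFun {φ : ℂ → ℂ} (hφ : IsUnivalentSelfMap φ) (n : ℕ) {f : ℂ → ℂ}
    (hf : DifferentiableOn ℂ f (ball 0 1)) {z : ℂ} (hz : z ∈ ball (0 : ℂ) 1) :
    deriv (compDiffFun φ n f) z = iteratedDeriv (n + 1) f (φ z) * deriv φ z := by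
  have h1 : compDiffFun φ n f =ᶠ[𝓝 z] iteratedDeriv n f ∘ φ := by
    filter_upwards [isOpen_ball.mem_nhds hz] with w hw using compDiffFun_apply φ n f hw
  have h2 := ((differentiableOn_iteratedDeriv_ball hf n).differentiableAt
    (isOpen_ball.mem_nhds (hφ.mapsTo hz))).hasDerivAt
  rw [h1.deriv_eq, (h2.comp z (hφ.hasDerivAt hz)).deriv, iteratedDeriv_succ]

/-- The weight hypothesis moves the weight from `z` to `φ(z)`, after which `w = φ(z)` can be
substituted. The factor `2` comes from `1 - |z|² ≤ 2 (1 - |z|)`. -/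
theorem lintegral_deriv_compDiffFun_le_of_weight {φ : ℂ → ℂ} (hφ : IsUnivalentSelfMap φ) (n : ℕ)
    (f : HardySpace) {s : Set ℂ} (hs : MeasurableSet s) (hs1 : s ⊆ ball 0 1) {M : ℝ} (hM : 0 ≤ M)
    (h : ∀ z ∈ s, 1 - ‖z‖ ≤ M * (1 - ‖φ z‖) ^ (2 * n + 1)) :
    ∫⁻ z in s, ENNReal.ofReal (‖deriv (compDiffFun φ n f) z‖ ^ 2 * (1 - ‖z‖ ^ 2)) ≤
      ENNReal.ofReal (2 * M * (π * (2 * n + 1).factorial * ‖f‖ ^ 2)) := by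
  calc _ ≤ ∫⁻ z in s, ENNReal.ofReal (2 * M) * (ENNReal.ofReal (‖deriv φ z‖ ^ 2) *
        ENNReal.ofReal (‖iteratedDeriv (n + 1) f (φ z)‖ ^ 2 *
          (1 - ‖φ z‖ ^ 2) ^ (2 * n + 1))) := by
        refine MeasureTheory.setLIntegral_mono' hs fun z hz => ?_
        have hz1 := mem_ball_zero_iff.1 (hs1 hz)
        have hφ1 := hφ.norm_lt_one (hs1 hz)
        rw [deriv_compDiffFun hφ n f.differentiableOn (hs1 hz),
          ← ENNReal.ofReal_mul (by positivity), ← ENNReal.ofReal_mul (by positivity)]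
        apply ENNReal.ofReal_le_ofReal
        have h1 : (1 - ‖φ z‖) ^ (2 * n + 1) ≤ (1 - ‖φ z‖ ^ 2) ^ (2 * n + 1) :=
          pow_le_pow_left₀ (by linarith) (by nlinarith [norm_nonneg (φ z)]) _
        have h2 : 1 - ‖z‖ ^ 2 ≤ 2 * M * (1 - ‖φ z‖ ^ 2) ^ (2 * n + 1) := by
          have := h z hz
          nlinarith [norm_nonneg z, mul_le_mul_of_nonneg_left h1 hM]
        rw [norm_mul, mul_pow]
        calc _ ≤ ‖iteratedDeriv (n + 1) f (φ z)‖ ^ 2 * ‖deriv φ z‖ ^ 2 *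
              (2 * M * (1 - ‖φ z‖ ^ 2) ^ (2 * n + 1)) := by gcongr
          _ = _ := by ring
    _ = ENNReal.ofReal (2 * M) * ∫⁻ z in s, ENNReal.ofReal (‖deriv φ z‖ ^ 2) *
        ENNReal.ofReal (‖iteratedDeriv (n + 1) f (φ z)‖ ^ 2 * (1 - ‖φ z‖ ^ 2) ^ (2 * n + 1)) :=
        MeasureTheory.lintegral_const_mul' _ _ ENNReal.ofReal_ne_top
    _ ≤ ENNReal.ofReal (2 * M) * ENNReal.ofReal (π * (2 * n + 1).factorial * ‖f‖ ^ 2) := by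
        gcongr
        exact (hφ.lintegral_comp_le hs hs1 fun w => ENNReal.ofReal
          (‖iteratedDeriv (n + 1) f w‖ ^ 2 * (1 - ‖w‖ ^ 2) ^ (2 * n + 1))).trans
          (f.lintegral_iteratedDeriv_le n)
    _ = _ := (ENNReal.ofReal_mul (by positivity)).symm

/-- Meant for the inner disk, where the weight is simply bounded by `1`: the integral of `|φ'|²`
over `s` is the area of `φ(s)`, at most `π`. -/
theorem lintegral_deriv_compDiffFun_le_of_bound {φ : ℂ → ℂ} (hφ : IsUnivalentSelfMap φ) (n : ℕ)
    (f : HardySpace) {s : Set ℂ} (hs : MeasurableSet s) (hs1 : s ⊆ ball 0 1) {B : ℝ} (hB : 0 ≤ B)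
    (h : ∀ z ∈ s, ‖iteratedDeriv (n + 1) f (φ z)‖ ^ 2 ≤ B) :
    ∫⁻ z in s, ENNReal.ofReal (‖deriv (compDiffFun φ n f) z‖ ^ 2 * (1 - ‖z‖ ^ 2)) ≤
      ENNReal.ofReal (B * π) := by
  calc _ ≤ ∫⁻ z in s, ENNReal.ofReal (‖deriv φ z‖ ^ 2) * ENNReal.ofReal B := by
        refine MeasureTheory.setLIntegral_mono' hs fun z hz => ?_
        rw [deriv_compDiffFun hφ n f.differentiableOn (hs1 hz),
          ← ENNReal.ofReal_mul (by positivity)]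
        apply ENNReal.ofReal_le_ofReal
        rw [norm_mul, mul_pow]
        calc _ ≤ B * ‖deriv φ z‖ ^ 2 * 1 := by
              have hz1 := mem_ball_zero_iff.1 (hs1 hz)
              refine mul_le_mul ?_ ?_ ?_ (by positivity)
              · exact mul_le_mul_of_nonneg_right (h z hz) (by positivity)
              · linarith [sq_nonneg ‖z‖]
              · nlinarith [norm_nonneg z]
          _ = _ := by ring
    _ ≤ ∫⁻ w in ball (0 : ℂ) 1, ENNReal.ofReal B :=
        hφ.lintegral_comp_le hs hs1 fun _ => ENNReal.ofReal B
    _ = _ := by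
        rw [MeasureTheory.setLIntegral_const, Complex.volume_ball, ENNReal.ofReal_mul hB]
        simp [NNReal.pi, ENNReal.ofReal, Real.toNNReal_of_nonneg pi_pos.le]
        rfl

theorem tsum_taylorCoeff_compDiffFun_le {φ : ℂ → ℂ} (hφ : IsUnivalentSelfMap φ) (n : ℕ)
    (f : HardySpace) {ρ M B : ℝ} (hM : 0 ≤ M) (hB : 0 ≤ B)
    (h1 : ∀ z : ℂ, ρ ≤ ‖z‖ → ‖z‖ < 1 → 1 - ‖z‖ ≤ M * (1 - ‖φ z‖) ^ (2 * n + 1))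
    (h2 : ∀ z ∈ ball (0 : ℂ) 1, ‖z‖ < ρ → ‖iteratedDeriv (n + 1) f (φ z)‖ ^ 2 ≤ B) :
    ∑' k, ENNReal.ofReal (‖taylorCoeff (compDiffFun φ n f) k‖ ^ 2) ≤
      ENNReal.ofReal (‖iteratedDeriv n f (φ 0)‖ ^ 2 + 2 * B +
        4 * M * (2 * n + 1).factorial * ‖f‖ ^ 2) := by
  refine (tsum_taylorCoeff_le (differentiableOn_compDiffFun hφ n f.differentiableOn)).trans ?_
  have hm : MeasurableSet {z : ℂ | ‖z‖ < ρ} := measurableSet_lt measurable_norm measurable_const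
  rw [← MeasureTheory.lintegral_inter_add_sdiff _ (ball (0 : ℂ) 1) hm,
    compDiffFun_apply φ n f (mem_ball_self one_pos)]
  have i1 := lintegral_deriv_compDiffFun_le_of_bound hφ n f (measurableSet_ball.inter hm)
    inter_subset_left hB fun z hz => h2 z hz.1 hz.2
  have i2 := lintegral_deriv_compDiffFun_le_of_weight hφ n f (measurableSet_ball.diff hm)
    sdiff_subset hM fun z hz => h1 z (not_lt.1 hz.2) (mem_ball_zero_iff.1 hz.1)
  calc _ ≤ ENNReal.ofReal (‖iteratedDeriv n f (φ 0)‖ ^ 2) + ENNReal.ofReal (2 / π) *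
        (ENNReal.ofReal (B * π) +
          ENNReal.ofReal (2 * M * (π * (2 * n + 1).factorial * ‖f‖ ^ 2))) := by gcongr
    _ = _ := by
        rw [← ENNReal.ofReal_add (by positivity) (by positivity),
          ← ENNReal.ofReal_mul (by positivity),
          ← ENNReal.ofReal_add (by positivity) (by positivity)]
        congr 1
        field_simp
        ring

theorem summable_and_tsum_le_of_ennreal {u : ℕ → ℝ} (hu : ∀ k, 0 ≤ u k) {X : ℝ} (hX : 0 ≤ X)
    (h : ∑' k, ENNReal.ofReal (u k) ≤ ENNReal.ofReal X) : Summable u ∧ ∑' k, u k ≤ X := by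
  have h1 : ∀ s : Finset ℕ, ∑ k ∈ s, u k ≤ X := fun s => by
    have := (ENNReal.sum_le_tsum s).trans h
    rwa [← ENNReal.ofReal_sum_of_nonneg fun k _ => hu k, ENNReal.ofReal_le_ofReal_iff hX] at this
  have h2 := summable_of_sum_le hu h1
  exact ⟨h2, h2.tsum_le_of_sum_le h1⟩

theorem IsCompDiff.coe_eq {φ : ℂ → ℂ} {n : ℕ} {T : HardySpace →ₗ[ℂ] HardySpace}
    (hT : IsCompDiff φ n T) (f : HardySpace) : (T f : ℂ → ℂ) = compDiffFun φ n f := by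
  funext z
  by_cases hz : z ∈ ball (0 : ℂ) 1
  · rw [hT f z hz, compDiffFun_apply φ n f hz]
  · rw [(T f).isHardy.2 z hz, compDiffFun, indicator_of_notMem hz]

theorem IsCompDiff.norm_sq_le {φ : ℂ → ℂ} {n : ℕ} {T : HardySpace →ₗ[ℂ] HardySpace}
    (hT : IsCompDiff φ n T) (f : HardySpace) {X : ℝ} (hX : 0 ≤ X)
    (h : ∑' k, ENNReal.ofReal (‖taylorCoeff (compDiffFun φ n f) k‖ ^ 2) ≤ ENNReal.ofReal X) :
    ‖T f‖ ^ 2 ≤ X := by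
  rw [← (T f).hasSum_coeff.tsum_eq]
  simp only [HardySpace.coeff, hT.coe_eq]
  exact (summable_and_tsum_le_of_ennreal (fun _ => by positivity) hX h).2

theorem contDiffAt_of_mem_ball {f : ℂ → ℂ} (hf : DifferentiableOn ℂ f (ball 0 1)) {z : ℂ}
    (hz : z ∈ ball (0 : ℂ) 1) (n : ℕ) : ContDiffAt ℂ n f z :=
  (hf.contDiffOn isOpen_ball).contDiffAt (isOpen_ball.mem_nhds hz)

/-- If `f⁽ⁿ⁾ ∘ φ` has `ℓ²` coefficients, controlled by `f`, then `D_{φ,n}` is bounded. -/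
theorem exists_isCompDiff {φ : ℂ → ℂ} (hφ : IsUnivalentSelfMap φ) (n : ℕ) {C : ℝ} (hC : 0 ≤ C)
    (h : ∀ f : HardySpace, ∑' k, ENNReal.ofReal (‖taylorCoeff (compDiffFun φ n f) k‖ ^ 2) ≤
      ENNReal.ofReal (C * ‖f‖ ^ 2)) :
    ∃ T : HardySpace →L[ℂ] HardySpace, IsCompDiff φ n (T : HardySpace →ₗ[ℂ] HardySpace) := by
  have hH : ∀ f : HardySpace, IsHardy (compDiffFun φ n f) := fun f =>
    isHardy_of_summable (differentiableOn_compDiffFun hφ n f.differentiableOn)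
      (fun z hz => indicator_of_notMem hz _)
      (summable_and_tsum_le_of_ennreal (fun _ => by positivity) (by positivity) (h f)).1
  let S : HardySpace → HardySpace := fun f => ⟨compDiffFun φ n f, hH f⟩
  have hS : ∀ f z, z ∈ ball (0 : ℂ) 1 → S f z = iteratedDeriv n f (φ z) := fun f z hz =>
    compDiffFun_apply φ n f hz
  have hext : ∀ {f g : HardySpace}, (∀ z ∈ ball (0 : ℂ) 1, f z = g z) → f = g := fun {f g} hfg =>
    DFunLike.ext _ _ fun z => by
      by_cases hz : z ∈ ball (0 : ℂ) 1
      · exact hfg z hz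
      · rw [f.isHardy.2 z hz, g.isHardy.2 z hz]
  let T : HardySpace →ₗ[ℂ] HardySpace :=
    { toFun := S
      map_add' := fun f g => hext fun z hz => by
        rw [hS _ z hz, HardySpace.coe_add, HardySpace.coe_add, Pi.add_apply, hS _ z hz, hS _ z hz,
          iteratedDeriv_add (contDiffAt_of_mem_ball f.differentiableOn (hφ.mapsTo hz) n)
            (contDiffAt_of_mem_ball g.differentiableOn (hφ.mapsTo hz) n)]
      map_smul' := fun c f => hext fun z hz => by
        rw [hS _ z hz, RingHom.id_apply, HardySpace.coe_smul, HardySpace.coe_smul, Pi.smul_apply,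
          hS _ z hz, iteratedDeriv_const_smul
            (contDiffAt_of_mem_ball f.differentiableOn (hφ.mapsTo hz) n) c] }
  have hT : IsCompDiff φ n T := hS
  refine ⟨T.mkContinuous √C fun f => ?_, hT⟩
  have h1 := hT.norm_sq_le f (by positivity) (h f)
  refine (pow_le_pow_iff_left₀ (norm_nonneg _) (by positivity) two_ne_zero).1 ?_
  rwa [mul_pow, Real.sq_sqrt hC]

end CompDiff

/-! ### Sufficiency -/

section Sufficiency

theorem IsUnivalentSelfMap.exists_norm_le {φ : ℂ → ℂ} (hφ : IsUnivalentSelfMap φ) {ρ : ℝ}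
    (hρ0 : 0 ≤ ρ) (hρ : ρ < 1) : ∃ r : ℝ, 0 ≤ r ∧ r < 1 ∧ ∀ z : ℂ, ‖z‖ ≤ ρ → ‖φ z‖ ≤ r := by
  have hsub : closedBall (0 : ℂ) ρ ⊆ ball 0 1 := closedBall_subset_ball hρ
  obtain ⟨z₀, hz₀, hmax⟩ := (isCompact_closedBall (0 : ℂ) ρ).exists_isMaxOn
    ⟨0, mem_closedBall_self hρ0⟩ (hφ.differentiableOn.continuousOn.mono hsub).norm
  exact ⟨‖φ z₀‖, norm_nonneg _, hφ.norm_lt_one (hsub hz₀),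
    fun z hz => hmax (mem_closedBall_zero_iff.2 hz)⟩

/-- The basic estimate of `f⁽ⁿ⁾ ∘ φ`, uniformly for functions vanishing to order `N` at `0`. -/
theorem exists_tsum_taylorCoeff_compDiffFun_le {φ : ℂ → ℂ} (hφ : IsUnivalentSelfMap φ) (n : ℕ)
    {ρ M : ℝ} (hρ0 : 0 ≤ ρ) (hρ : ρ < 1) (hM : 0 ≤ M)
    (h : ∀ z : ℂ, ρ ≤ ‖z‖ → ‖z‖ < 1 → 1 - ‖z‖ ≤ M * (1 - ‖φ z‖) ^ (2 * n + 1)) :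
    ∃ η : ℕ → ℝ, Tendsto η atTop (𝓝 0) ∧ (∀ N, 0 ≤ η N) ∧
      ∀ N, ∀ f : HardySpace, (∀ k < N, f.coeff k = 0) →
        ∑' k, ENNReal.ofReal (‖taylorCoeff (compDiffFun φ n f) k‖ ^ 2) ≤
          ENNReal.ofReal ((η N + 4 * M * (2 * n + 1).factorial) * ‖f‖ ^ 2) := by
  obtain ⟨r, hr0, hr, hφr⟩ := hφ.exists_norm_le hρ0 hρ
  obtain ⟨ε₁, hε₁, hε₁0, h₁⟩ := HardySpace.exists_tendsto_norm_iteratedDeriv_le n hr0 hr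
  obtain ⟨ε₂, hε₂, hε₂0, h₂⟩ := HardySpace.exists_tendsto_norm_iteratedDeriv_le (n + 1) hr0 hr
  refine ⟨fun N => ε₁ N ^ 2 + 2 * ε₂ N ^ 2, ?_, fun N => by positivity, fun N f hf => ?_⟩
  · simpa using (hε₁.pow 2).add ((hε₂.pow 2).const_mul 2)
  · refine (tsum_taylorCoeff_compDiffFun_le hφ n f hM (sq_nonneg (ε₂ N * ‖f‖)) h
      fun z _ hz => ?_).trans (ENNReal.ofReal_le_ofReal ?_)
    · exact pow_le_pow_left₀ (norm_nonneg _) (h₂ N f hf _ (hφr z hz.le)) 2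
    · have := pow_le_pow_left₀ (norm_nonneg _) (h₁ N f hf _ (hφr 0 (by simpa using hρ0))) 2
      linarith

theorem exists_isCompDiff_of_weight {φ : ℂ → ℂ} (hφ : IsUnivalentSelfMap φ) (n : ℕ)
    {ρ M : ℝ} (hρ0 : 0 ≤ ρ) (hρ : ρ < 1) (hM : 0 ≤ M)
    (h : ∀ z : ℂ, ρ ≤ ‖z‖ → ‖z‖ < 1 → 1 - ‖z‖ ≤ M * (1 - ‖φ z‖) ^ (2 * n + 1)) :
    ∃ T : HardySpace →L[ℂ] HardySpace, IsCompDiff φ n (T : HardySpace →ₗ[ℂ] HardySpace) := by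
  -- Only `N = 0` is used, where the vanishing condition is empty.
  obtain ⟨η, -, hη0, hη⟩ := exists_tsum_taylorCoeff_compDiffFun_le hφ n hρ0 hρ hM h
  have := hη0 0
  exact exists_isCompDiff hφ n (by positivity)
    fun f => hη 0 f fun k hk => absurd hk (Nat.not_lt_zero k)

theorem compDiffBounded_of_bddAbove {φ : ℂ → ℂ} (hφ : IsUnivalentSelfMap φ) (n : ℕ)
    (h : BddAbove ((fun w : ℂ => (1 - ‖w‖) / (1 - ‖φ w‖) ^ (2 * n + 1)) '' ball (0 : ℂ) 1)) :
    CompDiffBounded φ n := by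
  obtain ⟨M, hM⟩ := h
  have hM' : ∀ w ∈ ball (0 : ℂ) 1, (1 - ‖w‖) / (1 - ‖φ w‖) ^ (2 * n + 1) ≤ M := fun w hw =>
    hM (mem_image_of_mem _ hw)
  have hpos : ∀ w ∈ ball (0 : ℂ) 1, 0 < (1 - ‖φ w‖) ^ (2 * n + 1) := fun w hw =>
    pow_pos (sub_pos.2 (hφ.norm_lt_one hw)) _
  have hM0 : 0 ≤ M := by
    have h0 : (0 : ℂ) ∈ ball (0 : ℂ) 1 := mem_ball_self one_pos
    refine le_trans (div_nonneg ?_ (hpos 0 h0).le) (hM' 0 h0)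
    simp
  -- Here `ρ = 0`: the weight is controlled on the whole disk.
  obtain ⟨T, hT⟩ := exists_isCompDiff_of_weight hφ n le_rfl one_pos hM0 fun z _ hz => by
    have hz' := mem_ball_zero_iff.2 hz
    exact (div_le_iff₀ (hpos z hz')).1 (hM' z hz')
  exact ⟨T, hT, ‖T‖, T.le_opNorm⟩

/-- The order of choices matters: a small `M` fixes the radius `ρ'`, and only then is `N` taken
large enough to make the contribution of `|z| < ρ'` small. -/
theorem compDiffCompact_of_tendsto {φ : ℂ → ℂ} (hφ : IsUnivalentSelfMap φ) (n : ℕ)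
    (h : Tendsto (fun w : ℂ => (1 - ‖w‖) / (1 - ‖φ w‖) ^ (2 * n + 1))
      (comap (fun w : ℂ => ‖w‖) (𝓝[<] 1)) (𝓝 0)) :
    CompDiffCompact φ n := by
  have key : ∀ M : ℝ, 0 < M → ∃ ρ : ℝ, 0 ≤ ρ ∧ ρ < 1 ∧ ∀ z : ℂ, ρ ≤ ‖z‖ → ‖z‖ < 1 →
      1 - ‖z‖ ≤ M * (1 - ‖φ z‖) ^ (2 * n + 1) := fun M hM => by
    obtain ⟨s, hs, hsub⟩ := mem_comap.1 (h.eventually (ge_mem_nhds hM))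
    obtain ⟨l, hl, hls⟩ := mem_nhdsLT_iff_exists_Ioo_subset.1 hs
    have hl1 : l < 1 := hl
    refine ⟨max 0 ((l + 1) / 2), le_max_left _ _, max_lt one_pos (by linarith),
      fun z hz hz1 => ?_⟩
    have h1 : l < ‖z‖ := by linarith [(le_max_right 0 ((l + 1) / 2)).trans hz]
    have h2 : (1 - ‖z‖) / (1 - ‖φ z‖) ^ (2 * n + 1) ≤ M := hsub (hls ⟨h1, hz1⟩)
    exact (div_le_iff₀ (pow_pos (sub_pos.2
      (hφ.norm_lt_one (mem_ball_zero_iff.2 hz1))) _)).1 h2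
  -- The threshold `1` serves only to produce a bounded `T`.
  obtain ⟨ρ, hρ0, hρ, hw⟩ := key 1 one_pos
  obtain ⟨T, hT⟩ := exists_isCompDiff_of_weight hφ n hρ0 hρ zero_le_one hw
  refine ⟨T, hT, ?_⟩
  have hlim : Tendsto (fun N => T ∘L HardySpace.truncL N) atTop (𝓝 T) := by
    rw [tendsto_iff_norm_sub_tendsto_zero, Metric.tendsto_atTop']
    intro δ hδ
    set F : ℝ := ((2 * n + 1).factorial : ℝ) with hF
    have hF0 : 0 < F := by positivity
    -- With this `M` the term `4 M F` is `δ² / 16`; together with `η N ≤ δ² / 16` the total `δ² / 8`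
    -- stays below `(δ / 2)²`.
    obtain ⟨ρ', hρ0', hρ', hw'⟩ := key (δ ^ 2 / (64 * F)) (by positivity)
    obtain ⟨η, hη, hη0, hηb⟩ := exists_tsum_taylorCoeff_compDiffFun_le hφ n hρ0' hρ'
      (by positivity) hw'
    obtain ⟨N₀, hN₀⟩ := eventually_atTop.1 (hη.eventually (ge_mem_nhds
      (show (0 : ℝ) < δ ^ 2 / 16 by positivity)))
    refine ⟨N₀, fun N hN => ?_⟩
    rw [dist_zero_right, norm_norm]
    refine lt_of_le_of_lt (ContinuousLinearMap.opNorm_le_bound _ (half_pos hδ).le fun f => ?_)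
      (half_lt_self hδ)
    set g := f - HardySpace.truncL N f with hg
    have h1 : (T ∘L HardySpace.truncL N - T) f = -T g := by
      simp [hg]
    have h2 := hT.norm_sq_le g (by have := hη0 N; positivity) (hηb N g fun k hk => by
      rw [hg, HardySpace.coeff_sub_truncL, if_pos hk])
    have h3 : 4 * (δ ^ 2 / (64 * F)) * F = δ ^ 2 / 16 := by field_simp; norm_num
    rw [h1, norm_neg]
    refine (pow_le_pow_iff_left₀ (norm_nonneg _) (by positivity) two_ne_zero).1 ?_
    calc ‖T g‖ ^ 2 ≤ (η N + 4 * (δ ^ 2 / (64 * F)) * F) * ‖g‖ ^ 2 := h2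
      _ ≤ (δ ^ 2 / 16 + δ ^ 2 / 16) * ‖f‖ ^ 2 := by
        gcongr
        · exact hN₀ N hN.le
        · exact h3.le
        · exact HardySpace.norm_sub_truncL_le N f
      _ ≤ (δ / 2 * ‖f‖) ^ 2 := by nlinarith [sq_nonneg (δ * ‖f‖)]
  exact isCompactOperator_of_tendsto hlim
    (.of_forall fun N => HardySpace.isCompactOperator_comp_truncL T N)

end Sufficiency

/-! ### Necessity -/

section Necessity

theorem choose_add_le_pow (m j : ℕ) : (m + j).choose j ≤ (m + 1) ^ j := by
  induction j with
  | zero => simp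
  | succ j ih =>
    have h := Nat.add_one_mul_choose_eq (m + j) j
    have h1 : (m + j + 1) ≤ (m + 1) * (j + 1) := by nlinarith
    refine Nat.le_of_mul_le_mul_right (c := j + 1) ?_ j.succ_pos
    rw [← add_assoc, ← h, pow_succ]
    calc _ ≤ (m + 1) * (j + 1) * (m + 1) ^ j := Nat.mul_le_mul h1 ih
      _ = _ := by ring

/-- Both sides are compared with `(m + 1) ^ (2n)`. The left side is the coefficient of `x ^ m` in
`(1 - x)^(-(2n+1))`, the right side the one in the squared norm of `f ↦ f⁽ⁿ⁾(a)`, with `x = |a|²`.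
-/
theorem choose_le_sq_factorial_div (m n : ℕ) :
    ((m + 2 * n).choose (2 * n) : ℝ) ≤ ((m + n).factorial / m.factorial : ℝ) ^ 2 := by
  have h0 : (0 : ℝ) < m.factorial := by exact_mod_cast m.factorial_pos
  have h1 : ((m : ℝ) + 1) ^ n ≤ (m + n).factorial / m.factorial := by
    rw [le_div_iff₀ h0, ← Nat.factorial_mul_ascFactorial, mul_comm]
    push_cast
    gcongr
    exact_mod_cast Nat.pow_succ_le_ascFactorial (m + 1) n
  calc ((m + 2 * n).choose (2 * n) : ℝ) ≤ ((m : ℝ) + 1) ^ (2 * n) := by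
        exact_mod_cast choose_add_le_pow m (2 * n)
    _ = (((m : ℝ) + 1) ^ n) ^ 2 := by rw [← pow_mul, mul_comm]
    _ ≤ _ := by gcongr

/-- The norm of the functional `f ↦ f⁽ⁿ⁾(a)` is at least `(1 - |a|²)^(-(2n+1)/2)`. -/
theorem HardySpace.le_of_norm_iteratedDeriv_le {a : ℂ} (ha : a ∈ ball (0 : ℂ) 1) (n : ℕ)
    {W B : ℝ} (hW : 0 ≤ W)
    (h : ∀ f : HardySpace, W * ‖iteratedDeriv n f a‖ ^ 2 ≤ B * ‖f‖ ^ 2) :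
    W ≤ B * (1 - ‖a‖ ^ 2) ^ (2 * n + 1) := by
  have ha1 : ‖a‖ ^ 2 < 1 := pow_lt_one₀ (norm_nonneg _) (mem_ball_zero_iff.1 ha) two_ne_zero
  have hN : ∀ N, W * ∑ m ∈ Finset.range N,
      ((m + n).factorial / m.factorial : ℝ) ^ 2 * (‖a‖ ^ 2) ^ m ≤ B := fun N => by
    set S := ∑ m ∈ Finset.range N,
      ((m + n).factorial / m.factorial : ℝ) ^ 2 * (‖a‖ ^ 2) ^ m with hS
    have hS0 : 0 ≤ S := Finset.sum_nonneg fun _ _ => by positivity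
    -- The test function is a truncation of the kernel representing `f ↦ f⁽ⁿ⁾(a)`, so that `‖f‖²`
    -- and `f⁽ⁿ⁾(a)` both equal `S`.
    set b : ℕ → ℂ := fun k => if k < n then 0 else if k - n < N then
      (k.factorial / (k - n).factorial : ℂ) * conj a ^ (k - n) else 0 with hb
    have hbs : ∀ m, b (m + n) = if m < N then
        ((m + n).factorial / m.factorial : ℂ) * conj a ^ m else 0 := fun m => by
      simp [hb]
    have hsum : Summable fun k => ‖b k‖ ^ 2 := by
      refine summable_of_ne_finset_zero (s := Finset.range (N + n)) fun k hk => ?_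
      have : N + n ≤ k := by simpa using hk
      simp [hb, show ¬ k < n by omega, show ¬ k - n < N by omega]
    set f := ofCoeff b hsum with hf
    have hfc : ∀ k, f.coeff k = b k := coeff_ofCoeff b hsum
    have hnorm : ‖f‖ ^ 2 = S := by
      have h1 := (hasSum_nat_add_iff' n).2 f.hasSum_coeff
      rw [Finset.sum_eq_zero fun k hk => by simp [hfc, hb, Finset.mem_range.1 hk], sub_zero] at h1
      simp only [hfc, hbs] at h1
      refine h1.unique ?_
      rw [hS]
      convert hasSum_sum_of_ne_finset_zero (L := .unconditional ℕ) (s := Finset.range N) (fun m hm => ?_) using 1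
      · refine Finset.sum_congr rfl fun m hm => ?_
        rw [if_pos (Finset.mem_range.1 hm)]
        simp [mul_pow, ← pow_mul, mul_comm]
      · rw [if_neg (by simpa using hm)]
        simp
    have hder : iteratedDeriv n f a = S := by
      have h1 := hasSum_taylorCoeff (differentiableOn_iteratedDeriv_ball f.differentiableOn n) ha
      simp only [taylorCoeff_iteratedDeriv] at h1
      change HasSum (fun k => _ * f.coeff (k + n) * a ^ k) _ at h1
      simp only [hfc, hbs] at h1
      refine h1.unique ?_
      rw [hS, ofReal_sum]
      convert hasSum_sum_of_ne_finset_zero (L := .unconditional ℕ) (s := Finset.range N) (fun m hm => ?_) using 1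
      · refine Finset.sum_congr rfl fun m hm => ?_
        rw [if_pos (Finset.mem_range.1 hm)]
        push_cast
        rw [← conj_mul' a, mul_pow]
        ring
      · rw [if_neg (by simpa using hm)]
        simp
    have h2 := h f
    rw [hnorm, hder, norm_real, Real.norm_eq_abs, abs_of_nonneg hS0] at h2
    -- `S` vanishes only for the empty sum; then `0 ≤ B` is needed, and the constant function `1`
    -- provides it.
    rcases hS0.eq_or_lt with h0 | h0
    · rw [← h0, mul_zero]
      have h3 := h (monomial 0)
      have h4 : ‖monomial 0‖ ^ 2 = 1 := by
        refine (monomial 0).hasSum_coeff.unique ?_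
        convert hasSum_ite_eq 0 (1 : ℝ) using 2 with k
        rw [coeff_monomial]
        split_ifs <;> simp
      rw [h4, mul_one] at h3
      exact le_trans (by positivity) h3
    · refine le_of_mul_le_mul_right ?_ h0
      linarith
  -- The negative binomial series produces the power `2n + 1`.
  have hgeo := hasSum_choose_mul_geometric_of_norm_lt_one (𝕜 := ℝ) (2 * n) (r := ‖a‖ ^ 2)
    (by simpa using ha1)
  have hle : W * (1 / (1 - ‖a‖ ^ 2) ^ (2 * n + 1)) ≤ B := by
    refine le_of_tendsto (hgeo.tendsto_sum_nat.const_mul W) (.of_forall fun N => ?_)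
    refine le_trans ?_ (hN N)
    gcongr with m
    exact choose_le_sq_factorial_div m n
  have hp : 0 < (1 - ‖a‖ ^ 2) ^ (2 * n + 1) := pow_pos (by linarith) _
  rwa [mul_one_div, div_le_iff₀ hp] at hle

/-- Common to both necessity proofs: `T f w` is `f⁽ⁿ⁾(a)` at `a = φ(w)`, whose norm as a functional
is bounded below. The power of `2` comes from `1 - |a|² ≤ 2 (1 - |a|)`. -/
theorem ratio_le_of_evaluation_le {φ : ℂ → ℂ} (hφ : IsUnivalentSelfMap φ) {n : ℕ}
    {T : HardySpace →ₗ[ℂ] HardySpace} (hT : IsCompDiff φ n T) {w : ℂ} (hw : w ∈ ball (0 : ℂ) 1)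
    {B : ℝ} (h : ∀ f, (1 - ‖w‖ ^ 2) * ‖T f w‖ ^ 2 ≤ B * ‖f‖ ^ 2) :
    (1 - ‖w‖) / (1 - ‖φ w‖) ^ (2 * n + 1) ≤ 2 ^ (2 * n + 1) * B := by
  have hw1 := mem_ball_zero_iff.1 hw
  have hφ1 := hφ.norm_lt_one hw
  have hw2 : 0 < 1 - ‖w‖ ^ 2 := by nlinarith [norm_nonneg w]
  have h1 := HardySpace.le_of_norm_iteratedDeriv_le (hφ.mapsTo hw) n hw2.le fun f => by
    rw [← hT f w hw]; exact h f
  have hp : 0 < (1 - ‖φ w‖ ^ 2) ^ (2 * n + 1) := pow_pos (by nlinarith [norm_nonneg (φ w)]) _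
  have hB : 0 ≤ B := (pos_of_mul_pos_left (hw2.trans_le h1) hp.le).le
  rw [div_le_iff₀ (pow_pos (sub_pos.2 hφ1) _)]
  calc 1 - ‖w‖ ≤ 1 - ‖w‖ ^ 2 := by nlinarith [norm_nonneg w]
    _ ≤ B * (1 - ‖φ w‖ ^ 2) ^ (2 * n + 1) := h1
    _ ≤ B * (2 * (1 - ‖φ w‖)) ^ (2 * n + 1) := by
        gcongr
        · nlinarith [norm_nonneg (φ w)]
        · nlinarith [norm_nonneg (φ w)]
    _ = _ := by rw [mul_pow]; ring

theorem bddAbove_of_compDiffBounded {φ : ℂ → ℂ} (hφ : IsUnivalentSelfMap φ) {n : ℕ}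
    (h : CompDiffBounded φ n) :
    BddAbove ((fun w : ℂ => (1 - ‖w‖) / (1 - ‖φ w‖) ^ (2 * n + 1)) '' ball (0 : ℂ) 1) := by
  obtain ⟨T, hT, C, hC⟩ := h
  refine ⟨2 ^ (2 * n + 1) * C ^ 2, ?_⟩
  rintro _ ⟨w, hw, rfl⟩
  refine ratio_le_of_evaluation_le hφ hT hw fun f => ((T f).norm_sq_eval_le hw).trans ?_
  rw [← mul_pow]
  exact pow_le_pow_left₀ (norm_nonneg _) (hC f) 2

/-- A density argument: the normalised evaluations are uniformly bounded functionals, and they tend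
to `0` on polynomials because these are bounded on the disk. -/
theorem HardySpace.eventually_evaluation_le (f : HardySpace) {ε : ℝ} (hε : 0 < ε) :
    ∀ᶠ w in comap (fun w : ℂ => ‖w‖) (𝓝[<] 1), (1 - ‖w‖ ^ 2) * ‖f w‖ ^ 2 ≤ ε := by
  obtain ⟨N, hN⟩ := (f.tendsto_norm_sub_truncL.eventually
    (ge_mem_nhds (show (0 : ℝ) < ε / 4 by positivity))).exists
  set p := truncL N f with hp
  set C := ∑ k ∈ Finset.range N, ‖p.coeff k‖ with hC
  have hlim : Tendsto (fun w : ℂ => 2 * ((1 - ‖w‖ ^ 2) * C ^ 2))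
      (comap (fun w : ℂ => ‖w‖) (𝓝[<] 1)) (𝓝 0) := by
    have h1 : Tendsto (fun w : ℂ => ‖w‖) (comap (fun w : ℂ => ‖w‖) (𝓝[<] 1)) (𝓝 1) :=
      tendsto_comap.mono_right nhdsWithin_le_nhds
    simpa using (((h1.pow 2).const_sub 1).mul_const (C ^ 2)).const_mul 2
  filter_upwards [hlim.eventually (ge_mem_nhds (half_pos hε)),
    preimage_mem_comap self_mem_nhdsWithin] with w hw hw1
  have hw1' : ‖w‖ < 1 := hw1
  have hwb := mem_ball_zero_iff.2 hw1'
  have hpw : ‖p w‖ ≤ C := by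
    have h1 := hasSum_sum_of_ne_finset_zero (L := .unconditional ℕ) (f := fun k => p.coeff k * w ^ k)
      (s := Finset.range N) fun k hk => by
        rw [hp, coeff_truncL, if_neg (by simpa using hk), zero_mul]
    rw [(p.hasSum_eval hwb).unique h1]
    refine (norm_sum_le _ _).trans (Finset.sum_le_sum fun k _ => ?_)
    rw [norm_mul, norm_pow]
    exact mul_le_of_le_one_right (norm_nonneg _) (pow_le_one₀ (norm_nonneg _) hw1'.le)
  have h2 : f w = p w + (f - p) w := by
    have := congrFun (coe_add p (f - p)) w
    rwa [add_sub_cancel] at this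
  have h3 := (f - p).norm_sq_eval_le hwb
  have h4 : 0 ≤ 1 - ‖w‖ ^ 2 := by nlinarith [norm_nonneg w]
  have h5 : ‖f w‖ ^ 2 ≤ 2 * C ^ 2 + 2 * ‖(f - p) w‖ ^ 2 := by
    rw [h2]
    have := norm_add_le (p w) ((f - p) w)
    have := pow_le_pow_left₀ (norm_nonneg _) this 2
    have := pow_le_pow_left₀ (norm_nonneg _) hpw 2
    linarith [sq_nonneg (‖p w‖ - ‖(f - p) w‖)]
  linarith [mul_le_mul_of_nonneg_left h5 h4]

/-- Pointwise convergence of uniformly bounded functionals is uniform on compact sets, by a finite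
net of radius `√(ε / 4)`. -/
theorem HardySpace.eventually_evaluation_le_of_isCompact {K : Set HardySpace} (hK : IsCompact K)
    {ε : ℝ} (hε : 0 < ε) :
    ∀ᶠ w in comap (fun w : ℂ => ‖w‖) (𝓝[<] 1), ∀ f ∈ K, (1 - ‖w‖ ^ 2) * ‖f w‖ ^ 2 ≤ ε := by
  obtain ⟨t, -, ht, hcov⟩ := hK.finite_cover_balls (show 0 < √(ε / 4) by positivity)
  have h1 := (eventually_all_finite ht).2 fun g (_ : g ∈ t) =>
    g.eventually_evaluation_le (show 0 < ε / 4 by positivity)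
  filter_upwards [h1, preimage_mem_comap self_mem_nhdsWithin] with w hw hw1 f hf
  have hw1' : ‖w‖ < 1 := hw1
  obtain ⟨g, hg, hfg⟩ := mem_iUnion₂.1 (hcov hf)
  have h2 : f w = g w + (f - g) w := by
    have := congrFun (coe_add g (f - g)) w
    rwa [add_sub_cancel] at this
  have h3 := (f - g).norm_sq_eval_le (mem_ball_zero_iff.2 hw1')
  have h4 : 0 ≤ 1 - ‖w‖ ^ 2 := by nlinarith [norm_nonneg w]
  have h5 : ‖f w‖ ^ 2 ≤ 2 * ‖g w‖ ^ 2 + 2 * ‖(f - g) w‖ ^ 2 := by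
    rw [h2]
    have := norm_add_le (g w) ((f - g) w)
    have := pow_le_pow_left₀ (norm_nonneg _) this 2
    linarith [sq_nonneg (‖g w‖ - ‖(f - g) w‖)]
  have h6 : ‖f - g‖ ^ 2 ≤ ε / 4 := by
    have := pow_le_pow_left₀ (norm_nonneg _) (mem_ball_iff_norm.1 hfg).le 2
    rwa [Real.sq_sqrt (by positivity)] at this
  linarith [mul_le_mul_of_nonneg_left h5 h4, hw g hg]

theorem tendsto_of_compDiffCompact {φ : ℂ → ℂ} (hφ : IsUnivalentSelfMap φ) {n : ℕ}
    (h : CompDiffCompact φ n) :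
    Tendsto (fun w : ℂ => (1 - ‖w‖) / (1 - ‖φ w‖) ^ (2 * n + 1))
      (comap (fun w : ℂ => ‖w‖) (𝓝[<] 1)) (𝓝 0) := by
  obtain ⟨T, hT, hc⟩ := h
  obtain ⟨K, hK, hTK⟩ := hc.image_closedBall_subset_compact 1
  rw [Metric.tendsto_nhds]
  intro ε hε
  filter_upwards [HardySpace.eventually_evaluation_le_of_isCompact hK
    (show 0 < ε / 2 / 2 ^ (2 * n + 1) by positivity),
    preimage_mem_comap self_mem_nhdsWithin] with w hw hw1
  have hwb : w ∈ ball (0 : ℂ) 1 := mem_ball_zero_iff.2 hw1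
  -- The uniform bound concerns images of the unit ball; normalising `f` extends it to all of `H²`.
  -- The choice of `B` cancels the power of `2` and leaves `ε / 2 < ε`.
  have h1 := ratio_le_of_evaluation_le hφ hT hwb (B := ε / 2 / 2 ^ (2 * n + 1)) fun f => by
    rcases eq_or_ne f 0 with rfl | hf
    · simp [HardySpace.coe_zero]
    · have hf0 : 0 < ‖f‖ := norm_pos_iff.2 hf
      have h2 := hw (T ((‖f‖⁻¹ : ℂ) • f)) (hTK (mem_image_of_mem _ (by
        rw [mem_closedBall_zero_iff, norm_smul, norm_inv, norm_real, norm_norm,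
          inv_mul_cancel₀ hf0.ne'])))
      rw [map_smul, HardySpace.coe_smul, Pi.smul_apply, norm_smul, norm_inv, norm_real, norm_norm,
        mul_pow, inv_pow, mul_left_comm, ← div_eq_inv_mul, div_le_iff₀ (by positivity)] at h2
      exact h2
  rw [dist_zero_right, Real.norm_eq_abs, abs_of_nonneg (div_nonneg
    (sub_nonneg.2 (mem_ball_zero_iff.1 hwb).le)
    (pow_nonneg (sub_nonneg.2 (hφ.norm_lt_one hwb).le) _))]
  refine h1.trans_lt ?_
  rw [mul_div_cancel₀ _ (by positivity)]
  exact half_lt_self hε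

end Necessity

end

theorem mainTheorem3 (φ : ℂ → ℂ) (hφ : IsUnivalentSelfMap φ) (n : ℕ) (hn : 0 < n) :
    (CompDiffBounded φ n ↔
      BddAbove ((fun w : ℂ => (1 - ‖w‖) / (1 - ‖φ w‖) ^ (2 * n + 1)) '' ball (0 : ℂ) 1)) ∧
    (CompDiffCompact φ n ↔
      Tendsto (fun w : ℂ => (1 - ‖w‖) / (1 - ‖φ w‖) ^ (2 * n + 1))
        (comap (fun w : ℂ => ‖w‖) (𝓝[<] 1)) (𝓝 0)) :=
  ⟨⟨bddAbove_of_compDiffBounded hφ, compDiffBounded_of_bddAbove hφ n⟩,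
    ⟨tendsto_of_compDiffCompact hφ, compDiffCompact_of_tendsto hφ n⟩⟩
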